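/- **Setting.** Let $n\ge 1$ and let $\mathbb{R}_n$ be the real Clifford algebra with units $e_1,\dots,e_n$, $e_i^2=-1$, $e_ie_j=-e_je_i$ ($i\ne j$), basis $e_A$ and $|s|^2=\sum_A s_A^2$. Let $\mathbb{R}^{n+1}\subset\mathbb{R}_n$ be the paravectors $s=s_0+s_1e_1+\dots+s_ne_n$ with conjugate $\overline s=s_0-s_1e_1-\dots-s_ne_n$, and $\mathbb{S}=\{J\in\mathbb{R}^{n+1}: J_0=0,\ |J|=1\}$, $\mathbb{C}_J=\{x+Jy:x,y\in\mathbb{R}\}$. For a real Banach space $V_{\mathbb R}$ let $V=V_{\mathbb R}\otimes\mathbb{R}_n$ with $\|\sum_A v_A\otimes e_A\|^2=\sum_A\|v_A\|^2$ and its left and right multiplications by $\mathbb{R}_n$. Let $\mathcal{K}(V)$ be the closed right-linear operators with two-sided linear domain and $\mathcal{B}(V)$ the everywhere defined bounded right-linear operators. Products of operators have their natural domains, and $S\subseteq T$ means $\operatorname{dom}S\subseteq\operatorname{dom}T$ and $Sv=Tv$ on $\operatorname{dom}S$. For $T\in\mathcal{K}(V)$ and $s\in\mathbb{R}^{n+1}$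 put $Q_s[T]=T^2-2s_0T+|s|^2$ on $\operatorname{dom}(T^2)$, $\rho_S(T)=\{s\in\mathbb{R}^{n+1}: Q_s[T]^{-1}\in\mathcal{B}(V)\}$, $\sigma_S(T)=\mathbb{R}^{n+1}\setminus\rho_S(T)$, and $S_L^{-1}(s,T)=Q_s[T]^{-1}\overline{s}-TQ_s[T]^{-1}$ for $s\in\rho_S(T)$. For $\omega\in(0,\frac\pi2)$ let $I_\omega=(-\omega,\omega)\cup(\pi-\omega,\pi+\omega)$ and $D_\omega=\{s\in\mathbb{R}^{n+1}\setminus\{0\}:\operatorname{Arg}(s)\in I_\omega\}$, where $\operatorname{Arg}(s)$ is the argument of $s$ as a complex number in a plane $\mathbb{C}_J\ni s$. The operator $T\in\mathcal{K}(V)$ is *bisectorial of angle* $\omega\in(0,\frac\pi2)$ if $\sigma_S(T)\subseteq\overline{D_\omega}$ and for every $\varphi\in(\omega,\frac\pi2)$ there is $C_\varphi\ge0$ with $\|S_L^{-1}(s,T)\|\le C_\varphi/|s|$ for all $s\in\mathbb{R}^{n+1}\setminus(D_\varphi\cup\{0\})$. A function $g:D_\theta\to\mathbb{R}_n$ is *intrinsic*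 if $g(x+Jy)=g_0(x,y)+Jg_1(x,y)$ for all $J\in\mathbb{S}$ and all $(x,y)$ with $x+\mathbb{S}y\subseteq D_\theta$, where $g_0,g_1$ are real valued and continuously differentiable, $g_0$ is even and $g_1$ odd in $y$, and $\partial_xg_0=\partial_yg_1$, $\partial_yg_0=-\partial_xg_1$. Let $\mathcal{N}^0(D_\theta)$ be the set of bounded intrinsic $g$ with $\int_0^\infty|g(te^{J\phi})|\frac{dt}{t}<\infty$ for all $J\in\mathbb{S}$, $\phi\in I_\theta$. If $T$ is bisectorial of angle $\omega$, $\theta\in(\omega,\frac\pi2)$ and $g\in\mathcal{N}^0(D_\theta)$, put $$g(T)=\frac1{2\pi}\int_{\partial D_\varphi\cap\mathbb{C}_J}S_L^{-1}(s,T)\,ds_J\,g(s):=\frac1{2\pi}\sum_\pm\int_{\mathbb R}S_L^{-1}(\gamma_\pm(t),T)\,\frac{\gamma_\pm'(t)}{J}\,g(\gamma_\pm(t))\,dt,\qquad \gamma_\pm(t)=\pm|t|e^{-\operatorname{sgn}(t)J\varphi},$$ with $\varphi\in(\omega,\theta)$ and $J\in\mathbb{S}$; here $(Ba)(v)=B(av)$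 for an operator $B$ and $a\in\mathbb{R}_n$. **Theorem.** Let $T\in\mathcal{K}(V)$ be bisectorial of angle $\omega\in(0,\frac\pi2)$, $\theta\in(\omega,\frac\pi2)$ and $g\in\mathcal{N}^0(D_\theta)$. For every choice of $\varphi\in(\omega,\theta)$ and $J\in\mathbb{S}$ the integrals defining $g(T)$ converge absolutely in operator norm, and the following hold. 1. If $A\in\mathcal{K}(V)$ satisfies, for every $s\in\mathbb{R}^{n+1}\setminus\overline{D_\omega}$, $$AQ_s[T]^{-1}\supseteq Q_s[T]^{-1}A\quad\text{and}\quad ATQ_s[T]^{-1}\supseteq TQ_s[T]^{-1}A,$$ then $A\,g(T)\supseteq g(T)\,A$. 2. If $B\in\mathcal{B}(V)$ satisfies $TB\supseteq BT$, then $B\,g(T)=g(T)\,B$. 3. For every polynomial $p$ with real coefficients, $p[T]\,g(T)\supseteq g(T)\,p[T]$, where $p[T]=\sum_{k=0}^{m}p_kT^k$ on $\operatorname{dom}(T^m)$, $m=\deg p$ (and $p[T]=0$ on $V$ for $p=0$). 4. For every $f\in\mathcal{N}^0(D_\theta)$, $g(T)f(T)=f(T)g(T)$, also when $f(T)$ and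 $g(T)$ are computed with different choices of the angle and the imaginary unit. -/

import Mathlib

open Set Topology MeasureTheory
open scoped symmDiff

noncomputable section

namespace CliffordOp

/-! ### The Clifford algebra and Clifford modules -/

/-- The Clifford module `V = X ⊗ ℝ_n` over a real Banach space `X`: the vector `∑_A v_A ⊗ e_A` is
stored as the family `(v_A)`, where the ordered multi-indices `A = (i_1 < ... < i_r)` are the finite
subsets of `Fin n`.  The norm is `‖v‖² = ∑_A ‖v_A‖²`. -/
abbrev CliffordModule (n : ℕ) (X : Type*) := PiLp 2 (fun _ : Finset (Fin n) => X)

/-- The real Clifford algebra `ℝ_n`, with `|s|² = ∑_A s_A²`.  Its product is `lmul` with `X = ℝ`. -/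
abbrev Clifford (n : ℕ) := CliffordModule n ℝ

/-- The sign with `e_A e_B = cliffSign A B • e_{A ∆ B}`, forced by `e_i² = -1` and
`e_i e_j = - e_j e_i`: every pair `a ∈ A`, `b ∈ B` with `b < a` costs one transposition and every
common index costs one factor `e_i² = -1`. -/
def cliffSign {n : ℕ} (A B : Finset (Fin n)) : ℝ :=
  (-1) ^ ((A ×ˢ B).filter (fun p => p.2 ≤ p.1)).card

section Module

variable {n : ℕ} {X : Type*} [NormedAddCommGroup X] [NormedSpace ℝ X]

/-- Left multiplication `v ↦ s v = ∑_{B, A} (s_B v_A) ⊗ (e_B e_A)`; the coefficient at `e_C`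
collects the pairs with `B ∆ A = C`, that is `A = B ∆ C`. -/
def lmul (s : Clifford n) : CliffordModule n X →L[ℝ] CliffordModule n X where
  toFun v := WithLp.toLp 2 (fun C => ∑ B, (s B * cliffSign B (B ∆ C)) • v (B ∆ C))
  map_add' v w := by ext C; simp [Finset.sum_add_distrib]
  map_smul' r v := by
    ext C
    simp only [PiLp.smul_apply, RingHom.id_apply, Finset.smul_sum]
    exact Finset.sum_congr rfl fun B _ => smul_comm _ _ _
  cont := by fun_prop

/-- Right multiplication `v ↦ v s = ∑_{A, B} (s_B v_A) ⊗ (e_A e_B)`; the coefficient at `e_C`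
collects the pairs with `A ∆ B = C`, that is `A = C ∆ B`. -/
def rmul (s : Clifford n) : CliffordModule n X →L[ℝ] CliffordModule n X where
  toFun v := WithLp.toLp 2 (fun C => ∑ B, (s B * cliffSign (C ∆ B) B) • v (C ∆ B))
  map_add' v w := by ext C; simp [Finset.sum_add_distrib]
  map_smul' r v := by
    ext C
    simp only [PiLp.smul_apply, RingHom.id_apply, Finset.smul_sum]
    exact Finset.sum_congr rfl fun B _ => smul_comm _ _ _
  cont := by fun_prop

end Module

section Algebra

variable {n : ℕ}

/-- The basis vector `e_A`; in particular `e_∅ = 1`. -/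
def basisVec (A : Finset (Fin n)) : Clifford n := EuclideanSpace.single A (1 : ℝ)

/-- The multiplication table of the basis. -/
theorem lmul_basisVec (A B : Finset (Fin n)) :
    lmul (basisVec A) (basisVec B) = cliffSign A B • basisVec (A ∆ B) := by
  ext C
  by_cases h : C = A ∆ B
  · subst h
    simp [lmul, basisVec]
  · have h' : ¬ (A ∆ C = B) := by
      rintro rfl
      simp at h
    simp [lmul, basisVec, h, h']

/-- `e_i² = -1`. -/
theorem basisVec_sq (i : Fin n) : lmul (basisVec {i}) (basisVec {i}) = -basisVec ∅ := by
  rw [lmul_basisVec]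
  simp [cliffSign, Finset.filter_singleton]

/-- `e_i e_j = - e_j e_i` for `i ≠ j`. -/
theorem basisVec_anticomm (i j : Fin n) (hij : i ≠ j) :
    lmul (basisVec {i}) (basisVec {j}) = -lmul (basisVec {j}) (basisVec {i}) := by
  rw [lmul_basisVec, lmul_basisVec, symmDiff_comm ({j} : Finset (Fin n))]
  rcases lt_or_gt_of_ne hij with h | h <;>
    simp [cliffSign, Finset.filter_singleton, h.le, not_le.2 h]

/-- The real number `r` as an element of `ℝ_n`. -/
def ofReal (r : ℝ) : Clifford n := r • basisVec ∅

/-- Conjugation in `ℝ_n`. -/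
def conj (s : Clifford n) : Clifford n :=
  WithLp.toLp 2 (fun A => (-1 : ℝ) ^ (A.card * (A.card + 1) / 2) * s A)

variable (n) in
/-- The paravectors `ℝ^{n+1} = {s_0 + s_1 e_1 + ... + s_n e_n}` inside `ℝ_n`. -/
def paravectors : Set (Clifford n) := {s | ∀ A : Finset (Fin n), 2 ≤ A.card → s A = 0}

/-- The real part `s_0`. -/
def re (s : Clifford n) : ℝ := s ∅

/-- The imaginary part `Im s = s - s_0` of a paravector. -/
def im (s : Clifford n) : Clifford n := s - ofReal (re s)

variable (n) in
/-- The sphere `𝕊` of purely imaginary paravectors of modulus one. -/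
def unitSphere : Set (Clifford n) := {J | J ∈ paravectors n ∧ re J = 0 ∧ ‖J‖ = 1}

/-- `x + J y`. -/
def slicePoint (J : Clifford n) (x y : ℝ) : Clifford n := ofReal x + y • J

/-- `e^{J φ} = cos φ + J sin φ`. -/
def expI (J : Clifford n) (φ : ℝ) : Clifford n := slicePoint J (Real.cos φ) (Real.sin φ)

/-! ### Double sectors and intrinsic functions -/

/-- `I_ω = (-ω, ω) ∪ (π - ω, π + ω)`. -/
def angleSet (ω : ℝ) : Set ℝ := Ioo (-ω) ω ∪ Ioo (Real.pi - ω) (Real.pi + ω)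

/-- The argument of `s = s_0 + J |Im s|` as a complex number in `ℂ_J`, where `J = Im s / |Im s|`.
(The choice `-J` gives the negative angle, and `I_ω` is symmetric modulo `2π`.) -/
def arg (s : Clifford n) : ℝ := Complex.arg ⟨re s, ‖im s‖⟩

variable (n) in
/-- The open double sector `D_ω`. -/
def doubleSector (ω : ℝ) : Set (Clifford n) :=
  {s | s ∈ paravectors n ∧ s ≠ 0 ∧ arg s ∈ angleSet ω}

/-- The set `{(x, y) ∈ ℝ² | x + 𝕊 y ⊆ U}`. -/
def sliceDomain (U : Set (Clifford n)) : Set (ℝ × ℝ) :=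
  {z | ∀ J ∈ unitSphere n, slicePoint J z.1 z.2 ∈ U}

/-- `f` is left slice hyperholomorphic on `U` (axially symmetric and open in `ℝ^{n+1}`) with
components `f₀`, `f₁`. -/
structure IsLeftSliceWith (U : Set (Clifford n)) (f : Clifford n → Clifford n)
    (f₀ f₁ : ℝ × ℝ → Clifford n) : Prop where
  contDiffOn_fst : ContDiffOn ℝ 1 f₀ (sliceDomain U)
  contDiffOn_snd : ContDiffOn ℝ 1 f₁ (sliceDomain U)
  repr : ∀ z ∈ sliceDomain U, ∀ J ∈ unitSphere n,
    f (slicePoint J z.1 z.2) = f₀ z + lmul J (f₁ z)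
  even : ∀ z ∈ sliceDomain U, f₀ (z.1, -z.2) = f₀ z
  odd : ∀ z ∈ sliceDomain U, f₁ (z.1, -z.2) = -f₁ z
  cauchyRiemann_fst : ∀ z ∈ sliceDomain U, fderiv ℝ f₀ z (1, 0) = fderiv ℝ f₁ z (0, 1)
  cauchyRiemann_snd : ∀ z ∈ sliceDomain U, fderiv ℝ f₀ z (0, 1) = -fderiv ℝ f₁ z (1, 0)

/-- The intrinsic functions `𝒩(U)`: slice hyperholomorphic with real valued components. -/
def IsIntrinsic (U : Set (Clifford n)) (g : Clifford n → Clifford n) : Prop :=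
  ∃ g₀ g₁ : ℝ × ℝ → ℝ, IsLeftSliceWith U g (fun z => ofReal (g₀ z)) (fun z => ofReal (g₁ z))

/-- The space `𝒩⁰(D_θ)`.  Elements are functions on all of `ℝ_n` of which only the values on `D_θ`
matter. -/
structure IsIntrinsicDecaying (θ : ℝ) (g : Clifford n → Clifford n) : Prop where
  intrinsic : IsIntrinsic (doubleSector n θ) g
  bounded : ∃ M : ℝ, ∀ s ∈ doubleSector n θ, ‖g s‖ ≤ M
  integrable : ∀ J ∈ unitSphere n, ∀ φ ∈ angleSet θ,
    IntegrableOn (fun t : ℝ => ‖g (t • expI J φ)‖ / t) (Ioi 0)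

/-- The two parts (`ε = 1` and `ε = -1`) of the path `∂D_φ ∩ ℂ_J`,
`γ_±(t) = ± |t| e^{- sgn(t) J φ}`, `t ∈ ℝ`. -/
def sectorPath (φ : ℝ) (J : Clifford n) (ε : ℝ) (t : ℝ) : Clifford n :=
  (ε * |t|) • expI J (-(Real.sign t * φ))

end Algebra

/-! ### Unbounded operators -/

section Operators

variable {n : ℕ} {X : Type*} [NormedAddCommGroup X] [NormedSpace ℝ X]

/-- An everywhere defined bounded map, seen as a partially defined operator. -/
def toOp (B : CliffordModule n X →L[ℝ] CliffordModule n X) :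
    CliffordModule n X →ₗ.[ℝ] CliffordModule n X :=
  (B : CliffordModule n X →ₗ[ℝ] CliffordModule n X).toPMap ⊤

/-- The product `S T` with its natural domain `{v ∈ dom T | T v ∈ dom S}`.  Sums, real multiples and
the inclusion `≤` of operators are those of `LinearPMap`, with `dom (S + T) = dom S ∩ dom T`. -/
def opMul (S T : CliffordModule n X →ₗ.[ℝ] CliffordModule n X) :
    CliffordModule n X →ₗ.[ℝ] CliffordModule n X where
  domain := (S.domain.comap T.toFun).map T.domain.subtype
  toFun := S.toFun ∘ₗ LinearMap.codRestrict S.domain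
    (T.toFun ∘ₗ Submodule.inclusion (Submodule.map_subtype_le _ _)) (by
      rintro ⟨_, w, hw, rfl⟩
      exact hw)

/-- The powers `T^k` with their natural domains. -/
def opPow (T : CliffordModule n X →ₗ.[ℝ] CliffordModule n X) :
    ℕ → (CliffordModule n X →ₗ.[ℝ] CliffordModule n X)
  | 0 => toOp (ContinuousLinearMap.id ℝ _)
  | k + 1 => opMul T (opPow T k)

/-- The polynomial calculus `p[T] = p_0 + T p_1 + ... + T^m p_m`, `m = deg p`, for real coefficients,
with domain `dom (T^m)`. -/
def polyOp (p : Polynomial ℝ) (T : CliffordModule n X →ₗ.[ℝ] CliffordModule n X) :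
    CliffordModule n X →ₗ.[ℝ] CliffordModule n X :=
  ∑ k ∈ Finset.range (p.natDegree + 1), p.coeff k • opPow T k

/-- Right linearity of an everywhere defined bounded map; those maps form `ℬ(V)`. -/
def IsRightLinear (B : CliffordModule n X →L[ℝ] CliffordModule n X) : Prop :=
  ∀ (s : Clifford n) (v : CliffordModule n X), B (rmul s v) = rmul s (B v)

/-- The class `𝒦(V)` of closed right linear operators with two-sided linear domain. -/
structure IsClosedOperator (T : CliffordModule n X →ₗ.[ℝ] CliffordModule n X) : Prop where
  lmul_mem : ∀ (s : Clifford n), ∀ v ∈ T.domain, lmul s v ∈ T.domain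
  rmul_mem : ∀ (s : Clifford n), ∀ v ∈ T.domain, rmul s v ∈ T.domain
  map_rmul : ∀ (s : Clifford n) (v w : T.domain), (w : CliffordModule n X) = rmul s v →
    T w = rmul s (T v)
  isClosed : T.IsClosed

/-- `Q_s[T] = T² - 2 s_0 T + |s|²`, with domain `dom (T²)`. -/
def opQ (s : Clifford n) (T : CliffordModule n X →ₗ.[ℝ] CliffordModule n X) :
    CliffordModule n X →ₗ.[ℝ] CliffordModule n X :=
  opPow T 2 - (2 * re s) • T + (‖s‖ ^ 2) • toOp (ContinuousLinearMap.id ℝ _)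

/-- `R ∈ ℬ(V)` is the inverse of the operator `Q`. -/
def IsBoundedInverse (Q : CliffordModule n X →ₗ.[ℝ] CliffordModule n X)
    (R : CliffordModule n X →L[ℝ] CliffordModule n X) : Prop :=
  IsRightLinear R ∧ (∀ v, ∃ h : R v ∈ Q.domain, Q ⟨R v, h⟩ = v) ∧ ∀ v : Q.domain, R (Q v) = v

/-- The `S`-resolvent set. -/
def resolventSet (T : CliffordModule n X →ₗ.[ℝ] CliffordModule n X) : Set (Clifford n) :=
  {s | s ∈ paravectors n ∧ ∃ R, IsBoundedInverse (opQ s T) R}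

/-- The `S`-spectrum. -/
def sSpectrum (T : CliffordModule n X →ₗ.[ℝ] CliffordModule n X) : Set (Clifford n) :=
  paravectors n \ resolventSet T

open Classical in
/-- `Q_s[T]⁻¹ ∈ ℬ(V)` for `s` in the `S`-resolvent set (and `0` elsewhere). -/
def qInv (s : Clifford n) (T : CliffordModule n X →ₗ.[ℝ] CliffordModule n X) :
    CliffordModule n X →L[ℝ] CliffordModule n X :=
  if h : ∃ R, IsBoundedInverse (opQ s T) R then h.choose else 0

open Classical in
/-- The bounded map that an everywhere defined bounded operator `S` is (and `0` for other `S`). -/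
def toBounded (S : CliffordModule n X →ₗ.[ℝ] CliffordModule n X) :
    CliffordModule n X →L[ℝ] CliffordModule n X :=
  if h : ∃ B, toOp B = S then h.choose else 0

/-- The left `S`-resolvent operator `S_L⁻¹(s, T) = Q_s[T]⁻¹ s̄ - T Q_s[T]⁻¹`.  For closed `T` and `s`
in the `S`-resolvent set, `T Q_s[T]⁻¹` is closed and everywhere defined, hence bounded. -/
def leftResolvent (s : Clifford n) (T : CliffordModule n X →ₗ.[ℝ] CliffordModule n X) :
    CliffordModule n X →L[ℝ] CliffordModule n X :=
  qInv s T ∘L lmul (conj s) - toBounded (opMul T (toOp (qInv s T)))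

/-- `T` is bisectorial of angle `ω`. -/
structure IsBisectorial (ω : ℝ) (T : CliffordModule n X →ₗ.[ℝ] CliffordModule n X) : Prop where
  isClosedOperator : IsClosedOperator T
  sSpectrum_subset : sSpectrum T ⊆ closure (doubleSector n ω)
  bound : ∀ φ ∈ Ioo ω (Real.pi / 2), ∃ C : ℝ, 0 ≤ C ∧
    ∀ s ∈ paravectors n \ (doubleSector n φ ∪ {0}), ‖leftResolvent s T‖ ≤ C / ‖s‖

/-! ### The `ω`-functional calculus -/

/-- The integrand `S_L⁻¹(γ(t), T) (γ'(t) / J) f(γ(t))` of `∫_γ S_L⁻¹(s, T) ds_J f(s)` along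
`γ = γ_±`.  Here `γ' / J = -(γ' J)`, and an operator times a Clifford number `a` is `v ↦ B (a v)`. -/
def omegaIntegrand (T : CliffordModule n X →ₗ.[ℝ] CliffordModule n X) (φ : ℝ) (J : Clifford n)
    (f : Clifford n → Clifford n) (ε t : ℝ) : CliffordModule n X →L[ℝ] CliffordModule n X :=
  leftResolvent (sectorPath φ J ε t) T ∘L
    lmul (lmul (-(lmul (deriv (sectorPath φ J ε) t) J)) (f (sectorPath φ J ε t)))

/-- The `ω`-functional calculus `f(T) = (1 / 2π) ∫_{∂D_φ ∩ ℂ_J} S_L⁻¹(s, T) ds_J f(s)`, computed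
with the angle `φ` and the imaginary unit `J`; the integral is a Bochner integral of bounded
operators. -/
def omegaCalc (T : CliffordModule n X →ₗ.[ℝ] CliffordModule n X) (φ : ℝ) (J : Clifford n)
    (f : Clifford n → Clifford n) : CliffordModule n X →L[ℝ] CliffordModule n X :=
  (1 / (2 * Real.pi)) •
    ((∫ t : ℝ, omegaIntegrand T φ J f 1 t) + ∫ t : ℝ, omegaIntegrand T φ J f (-1) t)

end Operators

end CliffordOp

end

noncomputable section

namespace CliffordOp

/-! ### Arithmetic in a complex plane of the Clifford algebra -/

section Signs

variable {n : ℕ}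

/-! `Q_s[T]` depends on `s` only through `re s` and `‖s‖`, so conjugate points `s` and `s̄` share
the operators `Q_s[T]⁻¹` and `T Q_s[T]⁻¹`. The points at parameters `t` and `-t` of the path are
conjugate, and an intrinsic `g` takes conjugate values there. In the sum of the two integrands all
terms containing left multiplication by `J` therefore cancel, and only real multiples of `Q_s[T]⁻¹`
and `T Q_s[T]⁻¹` remain (`omegaIntegrand_add_neg`).

For a closed operator `S`, the bounded maps that send the graph of `S` into itself form a closed
real subspace, so this property passes from the symmetrized integrand to the integral. Hence `g(T)`
preserves the graph of every closed `S` whose graph is preserved by all `Q_s[T]⁻¹` and `T Q_s[T]⁻¹`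
(`preservesGraph_omegaCalc`).

The four claims are choices of `S`: the given `A`; a bounded `B` commuting with `T`, which then
commutes with both families (`PreservesGraph.comm_qInv`); `T` itself, which yields all its real
polynomials. The last choice also makes `g(T)` a bounded map commuting with `T`, so it commutes with
`f(T)` by the argument for `B`. Absolute convergence comes from the bound `C / |s|` on the resolvent
and the integrability of `|g| / t` on rays. -/

theorem cliffSign_eq_prod (A B : Finset (Fin n)) :
    cliffSign A B = ∏ p ∈ A ×ˢ B, if p.2 ≤ p.1 then (-1 : ℝ) else 1 := by
  rw [cliffSign, Finset.card_filter, ← Finset.prod_pow_eq_pow_sum]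
  refine Finset.prod_congr rfl fun p _ => ?_
  split_ifs <;> simp

/-- The factors over `A ∩ B` occur twice on the right and square to `1`. -/
theorem prod_symmDiff_of_mul_self {α : Type*} [DecidableEq α] (f : α → ℝ)
    (hf : ∀ a, f a * f a = 1) (A B : Finset α) :
    ∏ a ∈ A ∆ B, f a = (∏ a ∈ A, f a) * ∏ a ∈ B, f a := by
  have h1 : ∏ a ∈ A ∆ B, f a = (∏ a ∈ A \ B, f a) * ∏ a ∈ B \ A, f a :=
    Finset.prod_union (disjoint_sdiff_sdiff)
  have h2 := Finset.prod_inter_mul_prod_sdiff A B f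
  have h3 := Finset.prod_inter_mul_prod_sdiff B A f
  have h4 : (∏ a ∈ A ∩ B, f a) * ∏ a ∈ A ∩ B, f a = 1 := by
    rw [← Finset.prod_mul_distrib]
    exact Finset.prod_eq_one fun a _ => hf a
  rw [h1, ← h2, ← h3, Finset.inter_comm B A]
  linear_combination (-(∏ a ∈ A \ B, f a) * ∏ a ∈ B \ A, f a) * h4

theorem cliffSign_symmDiff_right (A B C : Finset (Fin n)) :
    cliffSign A (B ∆ C) = cliffSign A B * cliffSign A C := by
  simp only [cliffSign_eq_prod, Finset.prod_product]
  rw [← Finset.prod_mul_distrib]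
  refine Finset.prod_congr rfl fun a _ => prod_symmDiff_of_mul_self _ (fun b => ?_) _ _
  split_ifs <;> norm_num

theorem cliffSign_mul_self (A B : Finset (Fin n)) : cliffSign A B * cliffSign A B = 1 := by
  rw [cliffSign, ← mul_pow]
  norm_num

theorem cliffSign_empty_left (A : Finset (Fin n)) : cliffSign ∅ A = 1 := by
  simp [cliffSign]

theorem cliffSign_empty_right (A : Finset (Fin n)) : cliffSign A ∅ = 1 := by
  simp [cliffSign]

theorem cliffSign_singleton_self (i : Fin n) : cliffSign {i} {i} = -1 := by
  simp [cliffSign, Finset.filter_singleton]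

theorem cliffSign_singleton_swap {i j : Fin n} (hij : i ≠ j) :
    cliffSign {i} {j} + cliffSign {j} {i} = 0 := by
  rcases lt_or_gt_of_ne hij with h | h <;>
    simp [cliffSign, Finset.filter_singleton, h.le, not_le.2 h]

end Signs

/-! ### Left multiplication on the module and the identity `J² = -1` -/

section Multiplication

variable {n : ℕ} {X : Type*} [NormedAddCommGroup X] [NormedSpace ℝ X]

theorem lmul_apply (s : Clifford n) (v : CliffordModule n X) (C : Finset (Fin n)) :
    lmul s v C = ∑ B, (s B * cliffSign B (B ∆ C)) • v (B ∆ C) := rfl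

variable (n X) in
/-- Left multiplication as a linear map into the bounded operators. -/
def lmulHom : Clifford n →ₗ[ℝ] (CliffordModule n X →L[ℝ] CliffordModule n X) where
  toFun := lmul
  map_add' s t := by
    ext v C
    simp [lmul_apply, add_mul, add_smul, Finset.sum_add_distrib]
  map_smul' r s := by
    ext v C
    simp [lmul_apply, mul_assoc, mul_smul, Finset.smul_sum]

theorem lmul_add (s t : Clifford n) : (lmul (s + t) : CliffordModule n X →L[ℝ] _) = lmul s + lmul t :=
  (lmulHom n X).map_add s t

theorem lmul_smul (r : ℝ) (s : Clifford n) :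
    (lmul (r • s) : CliffordModule n X →L[ℝ] _) = r • lmul s :=
  (lmulHom n X).map_smul r s

theorem continuous_lmul :
    Continuous (lmul : Clifford n → CliffordModule n X →L[ℝ] CliffordModule n X) :=
  (lmulHom n X).continuous_of_finiteDimensional

variable (n X) in
theorem exists_norm_lmul_le : ∃ K : ℝ, 0 ≤ K ∧
    ∀ s : Clifford n, ‖(lmul s : CliffordModule n X →L[ℝ] CliffordModule n X)‖ ≤ K * ‖s‖ :=
  ⟨‖LinearMap.toContinuousLinearMap (lmulHom n X)‖, ContinuousLinearMap.opNorm_nonneg _,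
    fun s => (LinearMap.toContinuousLinearMap (lmulHom n X)).le_opNorm s⟩

theorem lmul_ofReal (r : ℝ) :
    (lmul (ofReal r) : CliffordModule n X →L[ℝ] _) = r • ContinuousLinearMap.id ℝ _ := by
  rw [ofReal, lmul_smul]
  congr 1
  ext v C
  rw [lmul_apply, Finset.sum_eq_single ∅]
  · have : ∅ ∆ C = C := bot_symmDiff C
    simp [basisVec, cliffSign_empty_left, this]
  · intro B _ hB
    simp [basisVec, hB]
  · simp

theorem lmul_one (s : Clifford n) : lmul s (ofReal 1) = s := by
  ext C
  rw [lmul_apply, Finset.sum_eq_single C]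
  · simp [ofReal, basisVec, cliffSign_empty_right]
  · intro B _ hB
    have : B ∆ C ≠ ∅ := by simpa [Finset.symmDiff_eq_empty] using hB
    simp [ofReal, basisVec, this]
  · simp

theorem sum_finset_eq_sum_singleton {E : Type*} [AddCommMonoid E] (f : Finset (Fin n) → E)
    (hf : ∀ A, A.card ≠ 1 → f A = 0) : ∑ A, f A = ∑ i, f {i} := by
  have h : ∑ i, f {i} = ∑ A ∈ Finset.univ.map ⟨fun i : Fin n => ({i} : Finset (Fin n)),
      Finset.singleton_injective⟩, f A := by simp
  rw [h]
  symm
  refine Finset.sum_subset (Finset.subset_univ _) fun A _ hA => hf A fun h1 => hA ?_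
  obtain ⟨i, rfl⟩ := Finset.card_eq_one.1 h1
  simp

theorem unitSphere_apply_eq_zero {J : Clifford n} (hJ : J ∈ unitSphere n) {A : Finset (Fin n)}
    (hA : A.card ≠ 1) : J A = 0 := by
  rcases Nat.lt_or_gt_of_ne hA with h | h
  · obtain rfl : A = ∅ := by simpa using h
    exact hJ.2.1
  · exact hJ.1 A h

theorem sum_sq_of_mem_unitSphere {J : Clifford n} (hJ : J ∈ unitSphere n) :
    ∑ i, J {i} ^ 2 = 1 := by
  have h := PiLp.norm_sq_eq_of_L2 (fun _ : Finset (Fin n) => ℝ) J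
  rw [hJ.2.2, sum_finset_eq_sum_singleton] at h
  · simpa using h.symm
  · intro A hA
    simp [unitSphere_apply_eq_zero hJ hA]

theorem lmul_apply_of_mem_unitSphere {J : Clifford n} (hJ : J ∈ unitSphere n)
    (v : CliffordModule n X) (C : Finset (Fin n)) :
    lmul J v C = ∑ i, (J {i} * cliffSign {i} ({i} ∆ C)) • v ({i} ∆ C) := by
  rw [lmul_apply, sum_finset_eq_sum_singleton]
  intro A hA
  simp [unitSphere_apply_eq_zero hJ hA]

/-- Anticommutation kills the mixed terms of `J²`, and the squares sum to `-|J|² = -1`. This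
replaces general associativity: every product used below lies in a single plane `ℂ_J`. -/
theorem lmul_lmul_of_mem_unitSphere {J : Clifford n} (hJ : J ∈ unitSphere n)
    (v : CliffordModule n X) : lmul J (lmul J v) = -v := by
  ext C
  set a : Fin n → Fin n → X := fun i j =>
    (J {i} * J {j} * (cliffSign {j} {i} * (cliffSign {i} C * cliffSign {j} C))) •
      v ({j} ∆ ({i} ∆ C)) with ha
  have h1 : lmul J (lmul J v) C = ∑ i, ∑ j, a i j := by
    rw [lmul_apply_of_mem_unitSphere hJ]
    refine Finset.sum_congr rfl fun i _ => ?_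
    rw [lmul_apply_of_mem_unitSphere hJ, Finset.smul_sum]
    refine Finset.sum_congr rfl fun j _ => ?_
    rw [smul_smul, ha]
    congr 1
    simp only [cliffSign_symmDiff_right, cliffSign_singleton_self]
    ring
  -- Cancellation is visible only after symmetrizing in `i` and `j`, so twice the double sum is
  -- computed.
  have h2 : ∀ i j, a i j + a j i = if i = j then (-2 * J {i} ^ 2) • v C else 0 := by
    intro i j
    split_ifs with h
    · subst h
      simp only [ha, symmDiff_symmDiff_cancel_left, cliffSign_singleton_self, cliffSign_mul_self]
      rw [← add_smul]
      congr 1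
      ring
    · have h3 : {i} ∆ ({j} ∆ C) = {j} ∆ ({i} ∆ C) := symmDiff_left_comm _ _ _
      simp only [ha, h3]
      rw [← add_smul]
      convert zero_smul ℝ _
      linear_combination (J {i} * J {j} * cliffSign {i} C * cliffSign {j} C) *
        cliffSign_singleton_swap h
  have h3 : (2 : ℝ) • ∑ i, ∑ j, a i j = (-2 : ℝ) • v C := by
    rw [two_smul]
    nth_rw 2 [Finset.sum_comm]
    simp only [← Finset.sum_add_distrib, h2, Finset.sum_ite_eq, Finset.mem_univ, if_true]
    rw [← Finset.sum_smul, ← Finset.mul_sum, sum_sq_of_mem_unitSphere hJ, mul_one]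
  rw [h1, PiLp.neg_apply]
  have h4 := congrArg (fun x => (1 / 2 : ℝ) • x) h3
  simpa [smul_smul] using h4

end Multiplication

/-! ### Coordinates `x + J y` in a complex plane -/

section Slice

variable {n : ℕ} {X : Type*} [NormedAddCommGroup X] [NormedSpace ℝ X]

theorem ofReal_apply_empty (r : ℝ) : (ofReal r : Clifford n) ∅ = r := by
  simp [ofReal, basisVec]

theorem ofReal_injective : Function.Injective (ofReal : ℝ → Clifford n) := fun a b h => by
  simpa [ofReal_apply_empty] using congrArg (fun s : Clifford n => s ∅) h

theorem ofReal_apply_of_ne {A : Finset (Fin n)} (hA : A ≠ ∅) (r : ℝ) :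
    (ofReal r : Clifford n) A = 0 := by
  simp [ofReal, basisVec, hA]

theorem continuous_re : Continuous (re : Clifford n → ℝ) := by
  unfold re
  fun_prop

theorem continuous_im : Continuous (im : Clifford n → Clifford n) := by
  unfold im ofReal
  have := continuous_re (n := n)
  fun_prop

theorem continuous_conj : Continuous (conj : Clifford n → Clifford n) := by
  unfold conj
  fun_prop

theorem continuous_slicePoint (J : Clifford n) :
    Continuous fun z : ℝ × ℝ => slicePoint J z.1 z.2 := by
  unfold slicePoint ofReal
  fun_prop

variable {J : Clifford n}

theorem re_slicePoint (hJ : J ∈ unitSphere n) (x y : ℝ) : re (slicePoint J x y) = x := by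
  have : J ∅ = 0 := hJ.2.1
  simp [re, slicePoint, ofReal_apply_empty, this]

theorem im_slicePoint (hJ : J ∈ unitSphere n) (x y : ℝ) : im (slicePoint J x y) = y • J := by
  rw [im, re_slicePoint hJ, slicePoint, add_sub_cancel_left]

theorem norm_im_slicePoint (hJ : J ∈ unitSphere n) (x y : ℝ) : ‖im (slicePoint J x y)‖ = |y| := by
  rw [im_slicePoint hJ, norm_smul, hJ.2.2, mul_one, Real.norm_eq_abs]

theorem slicePoint_mem_paravectors (hJ : J ∈ unitSphere n) (x y : ℝ) : slicePoint J x y ∈ paravectors n := by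
  intro A hA
  have hA' : A ≠ ∅ := by
    rintro rfl
    simp at hA
  simp [slicePoint, ofReal_apply_of_ne hA', hJ.1 A hA]

theorem norm_slicePoint (hJ : J ∈ unitSphere n) (x y : ℝ) : ‖slicePoint J x y‖ = Real.sqrt (x ^ 2 + y ^ 2) := by
  have h1 : inner ℝ (ofReal x : Clifford n) (y • J) = 0 := by
    have : J ∅ = 0 := hJ.2.1
    simp [ofReal, basisVec, inner_smul_left, inner_smul_right, EuclideanSpace.inner_single_left,
      this]
  have h2 := norm_add_sq_eq_norm_sq_add_norm_sq_of_inner_eq_zero _ _ h1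
  have h3 : ‖(ofReal x : Clifford n)‖ = |x| := by
    simp [ofReal, basisVec, norm_smul]
  rw [h3, norm_smul, hJ.2.2, mul_one, Real.norm_eq_abs, abs_mul_abs_self, abs_mul_abs_self] at h2
  rw [slicePoint, eq_comm, Real.sqrt_eq_iff_mul_self_eq (by positivity) (norm_nonneg _), h2]
  ring

theorem conj_slicePoint (hJ : J ∈ unitSphere n) (x y : ℝ) : conj (slicePoint J x y) = slicePoint J x (-y) := by
  ext A
  by_cases h1 : A.card = 1
  · have hA' : A ≠ ∅ := by
      rintro rfl
      simp at h1
    simp [conj, slicePoint, h1, ofReal_apply_of_ne hA']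
  · by_cases h2 : A = ∅
    · have : J ∅ = 0 := hJ.2.1
      subst h2
      simp [conj, slicePoint, ofReal_apply_empty, this]
    · simp [conj, slicePoint, ofReal_apply_of_ne h2, unitSphere_apply_eq_zero hJ h1]

theorem lmul_slicePoint (x y : ℝ) :
    (lmul (slicePoint J x y) : CliffordModule n X →L[ℝ] _) =
      x • ContinuousLinearMap.id ℝ _ + y • lmul J := by
  rw [slicePoint, lmul_add, lmul_ofReal, lmul_smul]

theorem lmul_slicePoint_comp (hJ : J ∈ unitSphere n) (x y a b : ℝ) :
    (lmul (slicePoint J x y) : CliffordModule n X →L[ℝ] _) ∘L lmul (slicePoint J a b) =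
      (x * a - y * b) • ContinuousLinearMap.id ℝ _ + (x * b + y * a) • lmul J := by
  ext1 v
  simp only [lmul_slicePoint, ContinuousLinearMap.comp_apply, _root_.add_apply,
    _root_.smul_apply, ContinuousLinearMap.id_apply, map_add, map_smul,
    lmul_lmul_of_mem_unitSphere hJ]
  module

theorem slicePoint_mul_slicePoint (hJ : J ∈ unitSphere n) (x y a b : ℝ) :
    lmul (slicePoint J x y) (slicePoint J a b) =
      slicePoint J (x * a - y * b) (x * b + y * a) := by
  -- The algebra is its own module over `X = ℝ`, so evaluating the operator identity at `1` gives
  -- the product.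
  have h := DFunLike.congr_fun (lmul_slicePoint_comp (X := ℝ) hJ x y a b) (ofReal 1)
  rw [ContinuousLinearMap.comp_apply, lmul_one] at h
  rw [h, _root_.add_apply, _root_.smul_apply,
    _root_.smul_apply, lmul_one, slicePoint]
  simp [ofReal]

theorem slicePoint_mul_unit (hJ : J ∈ unitSphere n) (x y : ℝ) : lmul (slicePoint J x y) J = slicePoint J (-y) x := by
  have h := slicePoint_mul_slicePoint hJ x y 0 1
  have h1 : slicePoint J 0 1 = J := by simp [slicePoint, ofReal]
  rw [h1] at h
  simpa using h

end Slice

/-! ### Operators through their graphs -/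

section Graphs

variable {n : ℕ} {X : Type*} [NormedAddCommGroup X] [NormedSpace ℝ X]

theorem mem_graph_toOp {B : CliffordModule n X →L[ℝ] CliffordModule n X}
    {x y : CliffordModule n X} : (x, y) ∈ (toOp B).graph ↔ B x = y := by
  rw [LinearPMap.mem_graph_iff]
  constructor
  · rintro ⟨z, rfl, hy⟩
    exact hy
  · intro h
    exact ⟨⟨x, trivial⟩, rfl, h⟩

theorem mem_graph_opMul {S T : CliffordModule n X →ₗ.[ℝ] CliffordModule n X}
    {x z : CliffordModule n X} :
    (x, z) ∈ (opMul S T).graph ↔ ∃ y, (x, y) ∈ T.graph ∧ (y, z) ∈ S.graph := by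
  constructor
  · intro h
    obtain ⟨⟨_, w, hw, rfl⟩, rfl, rfl⟩ := (LinearPMap.mem_graph_iff _).1 h
    exact ⟨T w, T.mem_graph w, S.mem_graph ⟨T w, hw⟩⟩
  · rintro ⟨y, h1, h2⟩
    obtain ⟨w, rfl, rfl⟩ := (LinearPMap.mem_graph_iff _).1 h1
    obtain ⟨u, hu, rfl⟩ := (LinearPMap.mem_graph_iff _).1 h2
    have hw : T w ∈ S.domain := by
      have := u.2
      rwa [hu] at this
    obtain rfl : u = ⟨T w, hw⟩ := Subtype.ext hu
    exact (LinearPMap.mem_graph_iff _).2 ⟨⟨w, w, hw, rfl⟩, rfl, rfl⟩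

theorem mem_graph_add {S T : CliffordModule n X →ₗ.[ℝ] CliffordModule n X}
    {x z : CliffordModule n X} :
    (x, z) ∈ (S + T).graph ↔ ∃ a b, (x, a) ∈ S.graph ∧ (x, b) ∈ T.graph ∧ a + b = z := by
  constructor
  · intro h
    obtain ⟨⟨w, hS, hT⟩, rfl, rfl⟩ := (LinearPMap.mem_graph_iff _).1 h
    exact ⟨_, _, S.mem_graph ⟨w, hS⟩, T.mem_graph ⟨w, hT⟩, rfl⟩
  · rintro ⟨a, b, h1, h2, rfl⟩
    obtain ⟨⟨w, hw⟩, rfl, rfl⟩ := (LinearPMap.mem_graph_iff _).1 h1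
    obtain ⟨⟨u, hu⟩, h, rfl⟩ := (LinearPMap.mem_graph_iff _).1 h2
    obtain rfl : u = w := h
    exact (LinearPMap.mem_graph_iff _).2 ⟨⟨u, hw, hu⟩, rfl, rfl⟩

theorem mem_graph_smul {S : CliffordModule n X →ₗ.[ℝ] CliffordModule n X} {r : ℝ}
    {x z : CliffordModule n X} :
    (x, z) ∈ (r • S).graph ↔ ∃ a, (x, a) ∈ S.graph ∧ r • a = z := by
  constructor
  · intro h
    obtain ⟨w, rfl, rfl⟩ := (LinearPMap.mem_graph_iff _).1 h
    exact ⟨_, S.mem_graph w, rfl⟩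
  · rintro ⟨a, h, rfl⟩
    obtain ⟨w, rfl, rfl⟩ := (LinearPMap.mem_graph_iff _).1 h
    exact (LinearPMap.mem_graph_iff _).2 ⟨w, rfl, rfl⟩

theorem mem_graph_opQ {T : CliffordModule n X →ₗ.[ℝ] CliffordModule n X} {s : Clifford n}
    {x z : CliffordModule n X} :
    (x, z) ∈ (opQ s T).graph ↔ ∃ x₁ x₂, (x, x₁) ∈ T.graph ∧ (x₁, x₂) ∈ T.graph ∧
      x₂ - (2 * re s) • x₁ + ‖s‖ ^ 2 • x = z := by
  simp only [opQ, sub_eq_add_neg, mem_graph_add, mem_graph_smul, mem_graph_toOp, opPow,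
    mem_graph_opMul, LinearPMap.neg_graph, Submodule.mem_map]
  constructor
  · rintro ⟨_, _, ⟨x₂, c, ⟨x₁, ⟨_, rfl, h1⟩, h2⟩, ⟨⟨u, w⟩, hu, hc⟩, rfl⟩, ⟨_, rfl, rfl⟩, rfl⟩
    obtain ⟨a, ha, rfl⟩ := mem_graph_smul.1 hu
    simp only [LinearMap.prodMap_apply, LinearMap.id_apply, LinearMap.neg_apply,
      Prod.mk.injEq] at hc
    obtain ⟨rfl, rfl⟩ := hc
    obtain rfl : x₁ = a := T.mem_graph_snd_inj h1 ha rfl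
    exact ⟨_, _, h1, h2, rfl⟩
  · rintro ⟨x₁, x₂, h1, h2, rfl⟩
    exact ⟨_, _, ⟨x₂, _, ⟨x₁, ⟨x, rfl, h1⟩, h2⟩,
      ⟨⟨x, (2 * re s) • x₁⟩, mem_graph_smul.2 ⟨_, h1, rfl⟩, rfl⟩, rfl⟩, ⟨_, rfl, rfl⟩, rfl⟩

/-- `B` maps the graph of `S` into itself, that is, `B S ⊆ S B`. -/
def PreservesGraph (B : CliffordModule n X →L[ℝ] CliffordModule n X)
    (S : CliffordModule n X →ₗ.[ℝ] CliffordModule n X) : Prop :=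
  ∀ x y, (x, y) ∈ S.graph → (B x, B y) ∈ S.graph

/-- This absorbs the domain conditions into a condition that is linear in `B`, and closed in `B`
when `S` is closed. -/
theorem opMul_toOp_le_iff {B : CliffordModule n X →L[ℝ] CliffordModule n X}
    {S : CliffordModule n X →ₗ.[ℝ] CliffordModule n X} :
    opMul (toOp B) S ≤ opMul S (toOp B) ↔ PreservesGraph B S := by
  rw [← LinearPMap.le_graph_iff]
  constructor
  · intro h x y hxy
    obtain ⟨z, h1, h2⟩ := mem_graph_opMul.1 (h (mem_graph_opMul.2 ⟨y, hxy, mem_graph_toOp.2 rfl⟩))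
    rwa [mem_graph_toOp.1 h1]
  · rintro h ⟨x, z⟩ hxz
    obtain ⟨y, h1, h2⟩ := mem_graph_opMul.1 hxz
    rw [← mem_graph_toOp.1 h2]
    exact mem_graph_opMul.2 ⟨_, mem_graph_toOp.2 rfl, h x y h1⟩

variable {B : CliffordModule n X →L[ℝ] CliffordModule n X}
  {S T : CliffordModule n X →ₗ.[ℝ] CliffordModule n X}

theorem preservesGraph_toOp_iff {B' : CliffordModule n X →L[ℝ] CliffordModule n X} :
    PreservesGraph B (toOp B') ↔ B' ∘L B = B ∘L B' := by
  simp only [PreservesGraph, mem_graph_toOp]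
  constructor
  · intro h
    ext1 x
    exact h x _ rfl
  · rintro h x _ rfl
    exact DFunLike.congr_fun h x

theorem PreservesGraph.opMul (hS : PreservesGraph B S) (hT : PreservesGraph B T) :
    PreservesGraph B (opMul S T) := by
  intro x z h
  obtain ⟨y, h1, h2⟩ := mem_graph_opMul.1 h
  exact mem_graph_opMul.2 ⟨_, hT _ _ h1, hS _ _ h2⟩

theorem PreservesGraph.add (hS : PreservesGraph B S) (hT : PreservesGraph B T) :
    PreservesGraph B (S + T) := by
  intro x z h
  obtain ⟨a, b, h1, h2, rfl⟩ := mem_graph_add.1 h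
  exact mem_graph_add.2 ⟨_, _, hS _ _ h1, hT _ _ h2, (B.map_add a b).symm⟩

theorem PreservesGraph.smul (hS : PreservesGraph B S) (r : ℝ) : PreservesGraph B (r • S) := by
  intro x z h
  obtain ⟨a, h1, rfl⟩ := mem_graph_smul.1 h
  exact mem_graph_smul.2 ⟨_, hS _ _ h1, (B.map_smul r a).symm⟩

theorem PreservesGraph.opPow (hT : PreservesGraph B T) : ∀ k, PreservesGraph B (opPow T k)
  | 0 => preservesGraph_toOp_iff.2 rfl
  | k + 1 => hT.opMul (hT.opPow k)

theorem preservesGraph_zero : PreservesGraph B 0 := by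
  intro x y h
  obtain ⟨w, rfl, rfl⟩ := (LinearPMap.mem_graph_iff _).1 h
  exact (LinearPMap.mem_graph_iff _).2 ⟨⟨B w, trivial⟩, rfl, (B.map_zero).symm⟩

theorem PreservesGraph.polyOp (hT : PreservesGraph B T) (p : Polynomial ℝ) :
    PreservesGraph B (polyOp p T) := by
  unfold CliffordOp.polyOp
  induction Finset.range (p.natDegree + 1) using Finset.induction_on with
  | empty => simpa using preservesGraph_zero
  | insert k s hk ih =>
    rw [Finset.sum_insert hk]
    exact ((hT.opPow k).smul _).add ih

end Graphs

/-! ### The operators `Q_s[T]⁻¹` and `T Q_s[T]⁻¹` -/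

section Resolvent

variable {n : ℕ} {X : Type*} [NormedAddCommGroup X] [NormedSpace ℝ X]

/-- The bounded operator `T Q_s[T]⁻¹`. -/
def opQInv (s : Clifford n) (T : CliffordModule n X →ₗ.[ℝ] CliffordModule n X) :
    CliffordModule n X →L[ℝ] CliffordModule n X :=
  toBounded (opMul T (toOp (qInv s T)))

theorem qInv_congr {T : CliffordModule n X →ₗ.[ℝ] CliffordModule n X} {s s' : Clifford n}
    (h1 : re s = re s') (h2 : ‖s‖ = ‖s'‖) : qInv s T = qInv s' T := by
  have h : opQ s T = opQ s' T := by rw [opQ, opQ, h1, h2]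
  unfold qInv
  rw [h]

theorem opQInv_congr {T : CliffordModule n X →ₗ.[ℝ] CliffordModule n X} {s s' : Clifford n}
    (h1 : re s = re s') (h2 : ‖s‖ = ‖s'‖) : opQInv s T = opQInv s' T := by
  unfold opQInv
  rw [qInv_congr h1 h2]

theorem leftResolvent_eq (s : Clifford n) (T : CliffordModule n X →ₗ.[ℝ] CliffordModule n X) :
    leftResolvent s T = qInv s T ∘L lmul (conj s) - opQInv s T := rfl

theorem isBoundedInverse_qInv {T : CliffordModule n X →ₗ.[ℝ] CliffordModule n X} {s : Clifford n}
    (hs : s ∈ resolventSet T) : IsBoundedInverse (opQ s T) (qInv s T) := by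
  unfold qInv
  rw [dif_pos hs.2]
  exact hs.2.choose_spec

/-- Resolvent identities below are proved by exhibiting `x`, `T x`, `T² x` and cancelling `Q_s[T]`.
-/
theorem qInv_eq_of_mem_graph {T : CliffordModule n X →ₗ.[ℝ] CliffordModule n X} {s : Clifford n}
    (hs : s ∈ resolventSet T) {x x₁ x₂ : CliffordModule n X} (h1 : (x, x₁) ∈ T.graph)
    (h2 : (x₁, x₂) ∈ T.graph) : qInv s T (x₂ - (2 * re s) • x₁ + ‖s‖ ^ 2 • x) = x := by
  obtain ⟨w, rfl, hw⟩ :=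
    (LinearPMap.mem_graph_iff _).1 (mem_graph_opQ (s := s).2 ⟨x₁, x₂, h1, h2, rfl⟩)
  dsimp only at hw
  rw [← hw]
  exact (isBoundedInverse_qInv hs).2.2 w

variable [CompleteSpace X] {T : CliffordModule n X →ₗ.[ℝ] CliffordModule n X} {s : Clifford n}

/-- Closed graph theorem: `T Q_s[T]⁻¹` is everywhere defined, and its graph is the preimage of the
closed graph of `T` under a continuous map. So the default value `0` in `toBounded` does not occur
here. -/
theorem toOp_opQInv (hT : IsClosedOperator T) (hs : s ∈ resolventSet T) :
    toOp (opQInv s T) = opMul T (toOp (qInv s T)) := by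
  have hdom : ∀ v, qInv s T v ∈ T.domain := by
    intro v
    obtain ⟨h, hv⟩ := (isBoundedInverse_qInv hs).2.1 v
    obtain ⟨x₁, x₂, h1, -, -⟩ := mem_graph_opQ.1 ((opQ s T).mem_graph ⟨_, h⟩)
    exact LinearPMap.mem_domain_of_mem_graph h1
  let U : CliffordModule n X →ₗ[ℝ] CliffordModule n X :=
    T.toFun ∘ₗ LinearMap.codRestrict T.domain (qInv s T).toLinearMap hdom
  have hU : ∀ v, (qInv s T v, U v) ∈ T.graph := fun v => T.mem_graph ⟨_, hdom v⟩
  have hclosed : IsClosed (U.graph : Set (CliffordModule n X × CliffordModule n X)) := by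
    have : (U.graph : Set (CliffordModule n X × CliffordModule n X)) =
        (fun p => (qInv s T p.1, p.2)) ⁻¹' T.graph := by
      ext ⟨v, w⟩
      simp only [SetLike.mem_coe, LinearMap.mem_graph_iff, mem_preimage]
      constructor
      · rintro rfl
        exact hU v
      · intro h
        exact T.mem_graph_snd_inj h (hU v) rfl
    rw [this]
    exact IsClosed.preimage (by fun_prop) hT.isClosed
  have hex : ∃ B, toOp B = opMul T (toOp (qInv s T)) := by
    refine ⟨⟨U, U.continuous_of_isClosed_graph hclosed⟩, LinearPMap.eq_of_eq_graph ?_⟩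
    ext ⟨v, w⟩
    rw [mem_graph_toOp, mem_graph_opMul]
    constructor
    · rintro rfl
      exact ⟨_, mem_graph_toOp.2 rfl, hU v⟩
    · rintro ⟨y, h1, h2⟩
      rw [← mem_graph_toOp.1 h1] at h2
      exact T.mem_graph_snd_inj (hU v) h2 rfl
  unfold opQInv toBounded
  rw [dif_pos hex]
  exact hex.choose_spec

theorem mem_graph_opQInv (hT : IsClosedOperator T) (hs : s ∈ resolventSet T)
    (v : CliffordModule n X) : (qInv s T v, opQInv s T v) ∈ T.graph := by
  have h : (v, opQInv s T v) ∈ (toOp (opQInv s T)).graph := mem_graph_toOp.2 rfl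
  rw [toOp_opQInv hT hs] at h
  obtain ⟨y, h1, h2⟩ := mem_graph_opMul.1 h
  rwa [mem_graph_toOp.1 h1]

/-- The second entry is `T² Q_s[T]⁻¹ v`, solved from `Q_s[T] Q_s[T]⁻¹ v = v`. -/
theorem mem_graph_opQInv_snd (hT : IsClosedOperator T) (hs : s ∈ resolventSet T)
    (v : CliffordModule n X) :
    (opQInv s T v, v + (2 * re s) • opQInv s T v - ‖s‖ ^ 2 • qInv s T v) ∈ T.graph := by
  obtain ⟨h, hv⟩ := (isBoundedInverse_qInv hs).2.1 v
  obtain ⟨x₁, x₂, h1, h2, h3⟩ := mem_graph_opQ.1 ((opQ s T).mem_graph ⟨_, h⟩)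
  obtain rfl := T.mem_graph_snd_inj h1 (mem_graph_opQInv hT hs v) rfl
  rw [hv] at h3
  have h4 : v + (2 * re s) • opQInv s T v - ‖s‖ ^ 2 • qInv s T v = x₂ := by
    rw [← eq_sub_iff_add_eq, sub_eq_iff_eq_add] at h3
    rw [h3]
    abel
  rwa [h4]

theorem opQInv_eq_of_mem_graph (hT : IsClosedOperator T) (hs : s ∈ resolventSet T)
    {x x₁ x₂ : CliffordModule n X} (h1 : (x, x₁) ∈ T.graph) (h2 : (x₁, x₂) ∈ T.graph) :
    opQInv s T (x₂ - (2 * re s) • x₁ + ‖s‖ ^ 2 • x) = x₁ :=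
  T.mem_graph_snd_inj (mem_graph_opQInv hT hs _) h1 (qInv_eq_of_mem_graph hs h1 h2)

/-- An operator that commutes with `T` commutes with `Q_s[T]⁻¹` and `T Q_s[T]⁻¹`. -/
theorem PreservesGraph.comm_qInv (hT : IsClosedOperator T) (hs : s ∈ resolventSet T)
    {B : CliffordModule n X →L[ℝ] CliffordModule n X} (hB : PreservesGraph B T) :
    B ∘L qInv s T = qInv s T ∘L B ∧ B ∘L opQInv s T = opQInv s T ∘L B := by
  -- This is `B v = Q_s[T] (B Q_s[T]⁻¹ v)`, with the powers of `T` already moved past `B`.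
  have key : ∀ v, B v = B (v + (2 * re s) • opQInv s T v - ‖s‖ ^ 2 • qInv s T v) -
      (2 * re s) • B (opQInv s T v) + ‖s‖ ^ 2 • B (qInv s T v) := by
    intro v
    simp only [map_add, map_sub, map_smul]
    abel
  constructor <;> ext1 v <;> simp only [ContinuousLinearMap.comp_apply]
  · rw [key v, qInv_eq_of_mem_graph hs (hB _ _ (mem_graph_opQInv hT hs v))
      (hB _ _ (mem_graph_opQInv_snd hT hs v))]
  · rw [key v, opQInv_eq_of_mem_graph hT hs (hB _ _ (mem_graph_opQInv hT hs v))
      (hB _ _ (mem_graph_opQInv_snd hT hs v))]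

theorem qInv_preservesGraph (hT : IsClosedOperator T) (hs : s ∈ resolventSet T) :
    PreservesGraph (qInv s T) T ∧ PreservesGraph (opQInv s T) T := by
  -- For `x ∈ dom T` the vector `T² Q_s[T]⁻¹ x` is a combination of elements of `dom T`. Hence `T
  -- Q_s[T]⁻¹ x ∈ dom (T²)`, and `Q_s[T]` sends it to `T x`.
  have key : ∀ x y, (x, y) ∈ T.graph → qInv s T y = opQInv s T x := by
    intro x y hxy
    have h0 := mem_graph_opQInv hT hs x
    have h1 := mem_graph_opQInv_snd hT hs x
    have h2 := T.graph.sub_mem (T.graph.add_mem hxy (T.graph.smul_mem (2 * re s) h1))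
      (T.graph.smul_mem (‖s‖ ^ 2) h0)
    have h3 := qInv_eq_of_mem_graph hs h1 h2
    rw [← h3]
    congr 1
    change y = y + (2 * re s) • (x + (2 * re s) • opQInv s T x - ‖s‖ ^ 2 • qInv s T x) -
      ‖s‖ ^ 2 • opQInv s T x - (2 * re s) • (x + (2 * re s) • opQInv s T x -
        ‖s‖ ^ 2 • qInv s T x) + ‖s‖ ^ 2 • opQInv s T x
    abel
  constructor
  · intro x y hxy
    rw [key x y hxy]
    exact mem_graph_opQInv hT hs x
  · intro x y hxy
    rw [← key x y hxy]
    exact mem_graph_opQInv hT hs y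

/-- The difference of two resolvents. -/
theorem qInv_sub_qInv (hT : IsClosedOperator T) {p : Clifford n} (hs : s ∈ resolventSet T)
    (hp : p ∈ resolventSet T) :
    let E := (2 * (re s - re p)) • opQInv p T + (‖p‖ ^ 2 - ‖s‖ ^ 2) • qInv p T
    qInv s T * (1 - E) = qInv p T ∧ opQInv s T * (1 - E) = opQInv p T := by
  intro E
  -- `1 - E` is `Q_s[T] Q_p[T]⁻¹`; here `T² Q_p[T]⁻¹ v` is written out.
  have key : ∀ v, (1 - E) v = (v + (2 * re p) • opQInv p T v - ‖p‖ ^ 2 • qInv p T v) -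
      (2 * re s) • opQInv p T v + ‖s‖ ^ 2 • qInv p T v := by
    intro v
    change v - ((2 * (re s - re p)) • opQInv p T v + (‖p‖ ^ 2 - ‖s‖ ^ 2) • qInv p T v) = _
    module
  constructor <;> ext1 v <;> rw [ContinuousLinearMap.mul_def, ContinuousLinearMap.comp_apply, key v]
  · exact qInv_eq_of_mem_graph hs (mem_graph_opQInv hT hp v) (mem_graph_opQInv_snd hT hp v)
  · exact opQInv_eq_of_mem_graph hT hs (mem_graph_opQInv hT hp v) (mem_graph_opQInv_snd hT hp v)

/-- Near `p` the factor `E` is invertible, so `Y = y E⁻¹` and continuity of inversion at `1`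
suffices. No prior bound on `Y` is needed. -/
theorem continuousWithinAt_of_mul_eq {α R : Type*} [TopologicalSpace α] [NormedRing R]
    [HasSummableGeomSeries R] {Y E : α → R} {y : R} {A : Set α} {p : α}
    (hE : ContinuousAt E p) (hE1 : E p = 1) (hY : ∀ a ∈ A, Y a * E a = y) (hp : p ∈ A) :
    ContinuousWithinAt Y A p := by
  have h1 : ContinuousAt (fun a => Ring.inverse (E a)) p := by
    have h := NormedRing.inverse_continuousAt (1 : Rˣ)
    rw [Units.val_one, ← hE1] at h
    exact ContinuousAt.comp (f := E) h hE
  have h2 : ∀ᶠ a in 𝓝 p, IsUnit (E a) := by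
    refine hE.eventually (Units.isOpen.mem_nhds ?_)
    change IsUnit (E p)
    rw [hE1]
    exact isUnit_one
  have h3 : ∀ a ∈ A, IsUnit (E a) → Y a = y * Ring.inverse (E a) := by
    intro a ha hu
    rw [← hY a ha, mul_assoc, Ring.mul_inverse_cancel _ hu, mul_one]
  refine ((continuousAt_const.mul h1).continuousWithinAt (s := A)).congr_of_eventuallyEq ?_
    (h3 p hp (by rw [hE1]; exact isUnit_one))
  filter_upwards [h2.filter_mono nhdsWithin_le_nhds, self_mem_nhdsWithin] with a ha1 ha2
  exact h3 a ha2 ha1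

theorem continuousOn_qInv (hT : IsClosedOperator T) :
    ContinuousOn (fun s => qInv s T) (resolventSet T) ∧
      ContinuousOn (fun s => opQInv s T) (resolventSet T) := by
  have hre := continuous_re (n := n)
  have hE : ∀ p : Clifford n, Continuous fun s : Clifford n =>
      1 - ((2 * (re s - re p)) • opQInv p T + (‖p‖ ^ 2 - ‖s‖ ^ 2) • qInv p T) := by
    intro p
    fun_prop
  refine ⟨fun p hp => ?_, fun p hp => ?_⟩
  · exact continuousWithinAt_of_mul_eq (y := qInv p T) (hE p).continuousAt (by ext1 v; simp)
      (fun s hs => (qInv_sub_qInv hT hs hp).1) hp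
  · exact continuousWithinAt_of_mul_eq (y := opQInv p T) (hE p).continuousAt (by ext1 v; simp)
      (fun s hs => (qInv_sub_qInv hT hs hp).2) hp

end Resolvent

/-! ### The integration path -/

section Path

variable {n : ℕ} {J : Clifford n} {φ θ ω ε t : ℝ}

/-- The real coordinate is even in `t` and the imaginary one odd, so `t ↦ -t` acts on the path as
conjugation. -/
theorem sectorPath_eq (φ : ℝ) (J : Clifford n) (ε t : ℝ) :
    sectorPath φ J ε t = slicePoint J (ε * |t| * Real.cos φ) (-(ε * t * Real.sin φ)) := by
  have h : Real.cos (-(Real.sign t * φ)) = Real.cos φ ∧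
      |t| * Real.sin (-(Real.sign t * φ)) = -(t * Real.sin φ) ∨ t = 0 := by
    rcases lt_trichotomy t 0 with h | h | h
    · simp [Real.sign_of_neg h, abs_of_neg h]
    · exact Or.inr h
    · simp [Real.sign_of_pos h, abs_of_pos h]
  rcases h with ⟨h1, h2⟩ | rfl
  · unfold sectorPath expI slicePoint ofReal
    rw [h1, smul_add, smul_smul, smul_smul, mul_assoc ε |t| (Real.sin _), h2]
    congr 2
    ring
  · simp [sectorPath, slicePoint, ofReal]

theorem hasDerivAt_abs_div (ht : t ≠ 0) : HasDerivAt (fun x : ℝ => |x|) (t / |t|) t := by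
  rcases lt_or_gt_of_ne ht with h | h
  · have := hasDerivAt_abs_neg h
    rwa [abs_of_neg h, div_neg, div_self ht]
  · have := hasDerivAt_abs_pos h
    rwa [abs_of_pos h, div_self ht]

theorem deriv_sectorPath (ht : t ≠ 0) :
    deriv (sectorPath φ J ε) t =
      slicePoint J (ε * (t / |t|) * Real.cos φ) (-(ε * Real.sin φ)) := by
  have h0 : sectorPath φ J ε = fun t => slicePoint J (ε * |t| * Real.cos φ)
      (-(ε * t * Real.sin φ)) := funext (sectorPath_eq φ J ε)
  rw [h0]
  refine HasDerivAt.deriv ?_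
  have h1 : HasDerivAt (fun t => ε * |t| * Real.cos φ) (ε * (t / |t|) * Real.cos φ) t :=
    ((hasDerivAt_abs_div ht).const_mul ε).mul_const _
  have h2 : HasDerivAt (fun t => -(ε * t * Real.sin φ)) (-(ε * 1 * Real.sin φ)) t :=
    (((hasDerivAt_id t).const_mul ε).mul_const _).neg
  rw [mul_one] at h2
  unfold slicePoint ofReal
  exact (h1.smul_const _).add (h2.smul_const _)

theorem norm_sectorPath (hJ : J ∈ unitSphere n) (hε : ε = 1 ∨ ε = -1) :
    ‖sectorPath φ J ε t‖ = |t| := by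
  have h1 : ε ^ 2 = 1 := by rcases hε with rfl | rfl <;> norm_num
  have h2 : (ε * |t| * Real.cos φ) ^ 2 + (-(ε * t * Real.sin φ)) ^ 2 = |t| ^ 2 := by
    linear_combination (ε ^ 2 * Real.cos φ ^ 2 - 1) * sq_abs t + t ^ 2 * h1 +
      (ε ^ 2 * t ^ 2) * Real.sin_sq_add_cos_sq φ
  rw [sectorPath_eq, norm_slicePoint hJ, h2, Real.sqrt_sq (abs_nonneg t)]

theorem sectorPath_mem_paravectors (hJ : J ∈ unitSphere n) :
    sectorPath φ J ε t ∈ paravectors n := by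
  rw [sectorPath_eq]
  exact slicePoint_mem_paravectors hJ _ _

theorem sectorPath_ne_zero (hJ : J ∈ unitSphere n) (hε : ε = 1 ∨ ε = -1) (ht : t ≠ 0) :
    sectorPath φ J ε t ≠ 0 := by
  rw [← norm_ne_zero_iff, norm_sectorPath hJ hε]
  exact abs_ne_zero.2 ht

theorem arg_eq_of_polar {s : Clifford n} {r ψ : ℝ} (hr : 0 < r) (hψ : ψ ∈ Ioc (-Real.pi) Real.pi)
    (h1 : re s = r * Real.cos ψ) (h2 : ‖im s‖ = r * Real.sin ψ) : arg s = ψ := by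
  rw [arg, ← Complex.arg_mul_cos_add_sin_mul_I hr hψ]
  congr 1
  apply Complex.ext <;> simp [h1, h2, ← Complex.ofReal_cos, ← Complex.ofReal_sin]

theorem arg_sectorPath (hJ : J ∈ unitSphere n) (hε : ε = 1 ∨ ε = -1) (h0 : 0 < φ)
    (hφ : φ < Real.pi / 2) (ht : t ≠ 0) :
    arg (sectorPath φ J ε t) = φ ∨ arg (sectorPath φ J ε t) = Real.pi - φ := by
  have hpi := Real.pi_pos
  have hsin : 0 < Real.sin φ := Real.sin_pos_of_pos_of_lt_pi h0 (by linarith)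
  have ht' := abs_pos.2 ht
  rw [sectorPath_eq]
  rcases hε with rfl | rfl
  · refine Or.inl (arg_eq_of_polar ht' ⟨by linarith, by linarith⟩ ?_ ?_)
    · rw [re_slicePoint hJ, one_mul]
    · rw [norm_im_slicePoint hJ, one_mul, abs_neg, abs_mul, abs_of_pos hsin]
  · refine Or.inr (arg_eq_of_polar ht' ⟨by linarith, by linarith⟩ ?_ ?_)
    · rw [re_slicePoint hJ, Real.cos_pi_sub]
      ring
    · rw [norm_im_slicePoint hJ, Real.sin_pi_sub, abs_neg, abs_mul, abs_of_pos hsin]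
      simp

theorem sectorPath_mem_doubleSector (hJ : J ∈ unitSphere n) (hε : ε = 1 ∨ ε = -1) (h0 : 0 < φ)
    (hφ : φ < θ) (hθ : θ < Real.pi / 2) (ht : t ≠ 0) :
    sectorPath φ J ε t ∈ doubleSector n θ := by
  refine ⟨sectorPath_mem_paravectors hJ, sectorPath_ne_zero hJ hε ht, ?_⟩
  rcases arg_sectorPath hJ hε h0 (by linarith) ht with h | h <;> rw [h]
  · exact Or.inl ⟨by linarith, hφ⟩
  · exact Or.inr ⟨by linarith, by linarith⟩

theorem sectorPath_notMem_doubleSector (hJ : J ∈ unitSphere n) (hε : ε = 1 ∨ ε = -1)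
    (h0 : 0 < φ) (hφ : φ < Real.pi / 2) (ht : t ≠ 0) :
    sectorPath φ J ε t ∉ doubleSector n φ := by
  rintro ⟨-, -, h⟩
  rcases arg_sectorPath hJ hε h0 hφ ht with h' | h' <;> rw [h'] at h <;>
    rcases h with ⟨h1, h2⟩ | ⟨h1, h2⟩ <;> linarith

/-- The right side is the closed double cone cut out by a non-strict inequality between continuous
functions; this inclusion is enough to keep the path off the spectrum. On `D_ω` it says `sin (ω -
arg s) ≥ 0` or `sin (arg s + ω - π) ≥ 0`, multiplied by the modulus. -/
theorem closure_doubleSector_subset (hω : ω < Real.pi / 2) :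
    closure (doubleSector n ω) ⊆
      {s | ‖im s‖ * Real.cos ω ≤ |re s| * Real.sin ω} := by
  have hre := continuous_re (n := n)
  have him := continuous_im (n := n)
  refine closure_minimal ?_ (isClosed_le (by fun_prop) (by fun_prop))
  rintro s ⟨-, -, hs⟩
  change arg s ∈ angleSet ω at hs
  set z : ℂ := ⟨re s, ‖im s‖⟩ with hz
  have hpi := Real.pi_pos
  have h0 : 0 ≤ arg s := Complex.arg_nonneg_iff.2 (norm_nonneg _)
  have h1 : arg s ≤ Real.pi := Complex.arg_le_pi _
  have hcos : ‖z‖ * Real.cos (arg s) = re s := Complex.norm_mul_cos_arg z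
  have hsin : ‖z‖ * Real.sin (arg s) = ‖im s‖ := Complex.norm_mul_sin_arg z
  have hω0 : 0 < ω := by
    rcases hs with ⟨h2, h3⟩ | ⟨h2, h3⟩ <;> linarith
  have hs0 : 0 ≤ Real.sin ω := (Real.sin_pos_of_pos_of_lt_pi hω0 (by linarith)).le
  change ‖im s‖ * Real.cos ω ≤ |re s| * Real.sin ω
  rcases hs with ⟨h2, h3⟩ | ⟨h2, h3⟩
  · have h4 : 0 ≤ Real.sin (ω - arg s) := Real.sin_nonneg_of_nonneg_of_le_pi (by linarith)
      (by linarith)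
    rw [Real.sin_sub] at h4
    have h5 := mul_nonneg (norm_nonneg z) h4
    have h6 := mul_le_mul_of_nonneg_right (le_abs_self (re s)) hs0
    rw [← hsin]
    rw [← hcos] at h6 ⊢
    linarith
  · have h4 : 0 ≤ Real.sin (arg s + ω - Real.pi) :=
      Real.sin_nonneg_of_nonneg_of_le_pi (by linarith) (by linarith)
    rw [Real.sin_sub_pi, Real.sin_add] at h4
    have h5 := mul_nonneg (norm_nonneg z) h4
    have h6 := mul_le_mul_of_nonneg_right (neg_le_abs (re s)) hs0
    rw [← hsin]
    rw [← hcos] at h6 ⊢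
    linarith

theorem sectorPath_notMem_closure (hJ : J ∈ unitSphere n) (hε : ε = 1 ∨ ε = -1)
    (hω : 0 < ω) (hωφ : ω < φ) (hφ : φ < Real.pi / 2) (ht : t ≠ 0) :
    sectorPath φ J ε t ∉ closure (doubleSector n ω) := by
  intro h
  have hpi := Real.pi_pos
  have h1 := closure_doubleSector_subset (by linarith) h
  rw [mem_ofPred_eq, sectorPath_eq, norm_im_slicePoint hJ, re_slicePoint hJ, abs_neg] at h1
  have hε1 : |ε| = 1 := by rcases hε with rfl | rfl <;> simp
  have hsin : 0 < Real.sin φ := Real.sin_pos_of_pos_of_lt_pi (by linarith) (by linarith)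
  have hcos : 0 < Real.cos φ := Real.cos_pos_of_mem_Ioo ⟨by linarith, by linarith⟩
  simp only [abs_mul, hε1, one_mul, abs_abs, abs_of_pos hsin, abs_of_pos hcos] at h1
  have h2 : 0 < Real.sin (φ - ω) := Real.sin_pos_of_pos_of_lt_pi (by linarith) (by linarith)
  rw [Real.sin_sub] at h2
  have h3 := mul_pos (abs_pos.2 ht) h2
  linarith

end Path

/-! ### Intrinsic functions on the path -/

section Intrinsic

variable {n : ℕ} {J : Clifford n} {φ θ ε t : ℝ} {g : Clifford n → Clifford n}

theorem mem_sliceDomain_path (hε : ε = 1 ∨ ε = -1) (h0 : 0 < φ)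
    (hφ : φ < θ) (hθ : θ < Real.pi / 2) (ht : t ≠ 0) :
    (ε * |t| * Real.cos φ, -(ε * t * Real.sin φ)) ∈ sliceDomain (doubleSector n θ) := by
  intro J hJ
  rw [← sectorPath_eq]
  exact sectorPath_mem_doubleSector hJ hε h0 hφ hθ ht

theorem lmul_ofReal_right (s : Clifford n) (r : ℝ) : lmul s (ofReal r) = r • s := by
  have h : (ofReal r : Clifford n) = r • ofReal 1 := by simp [ofReal]
  rw [h, map_smul, lmul_one]

/-- On the path, an intrinsic function has components that are even and odd in `t`. -/
theorem IsIntrinsic.exists_components (hg : IsIntrinsic (doubleSector n θ) g)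
    (hJ : J ∈ unitSphere n) (hε : ε = 1 ∨ ε = -1) (h0 : 0 < φ) (hφ : φ < θ)
    (hθ : θ < Real.pi / 2) :
    ∃ a b : ℝ → ℝ, ∀ t ≠ 0, g (sectorPath φ J ε t) = slicePoint J (a t) (b t) ∧
      a (-t) = a t ∧ b (-t) = -b t := by
  obtain ⟨g₀, g₁, h⟩ := hg
  refine ⟨fun t => g₀ (ε * |t| * Real.cos φ, -(ε * t * Real.sin φ)),
    fun t => g₁ (ε * |t| * Real.cos φ, -(ε * t * Real.sin φ)), fun t ht => ⟨?_, ?_, ?_⟩⟩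
  · rw [sectorPath_eq, h.repr _ (mem_sliceDomain_path hε h0 hφ hθ ht) J hJ, lmul_ofReal_right]
    rfl
  · have h1 := ofReal_injective (h.even _ (mem_sliceDomain_path hε h0 hφ hθ ht))
    simpa [abs_neg, mul_neg, neg_mul] using h1
  · have h1 := h.odd _ (mem_sliceDomain_path hε h0 hφ hθ ht)
    have h2 : ∀ r : ℝ, -(ofReal r : Clifford n) = ofReal (-r) := fun r => by simp [ofReal]
    rw [h2] at h1
    simpa [abs_neg, mul_neg, neg_mul] using ofReal_injective h1

theorem IsIntrinsic.continuousOn_path (hg : IsIntrinsic (doubleSector n θ) g)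
    (hJ : J ∈ unitSphere n) (hε : ε = 1 ∨ ε = -1) (h0 : 0 < φ) (hφ : φ < θ)
    (hθ : θ < Real.pi / 2) :
    ContinuousOn (fun t => g (sectorPath φ J ε t)) {0}ᶜ := by
  obtain ⟨g₀, g₁, h⟩ := hg
  have hmaps : MapsTo (fun t : ℝ => (ε * |t| * Real.cos φ, -(ε * t * Real.sin φ))) {0}ᶜ
      (sliceDomain (doubleSector n θ)) := fun t ht => mem_sliceDomain_path hε h0 hφ hθ ht
  have hc : Continuous (fun t : ℝ => (ε * |t| * Real.cos φ, -(ε * t * Real.sin φ))) := by fun_prop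
  have h1 := h.contDiffOn_fst.continuousOn.comp hc.continuousOn hmaps
  have h2 := h.contDiffOn_snd.continuousOn.comp hc.continuousOn hmaps
  refine (h1.add ((lmul J).continuous.comp_continuousOn h2)).congr fun t ht => ?_
  rw [sectorPath_eq, h.repr _ (mem_sliceDomain_path hε h0 hφ hθ ht) J hJ]
  rfl

theorem smul_expI (J : Clifford n) (r φ : ℝ) :
    r • expI J φ = slicePoint J (r * Real.cos φ) (r * Real.sin φ) := by
  simp [expI, slicePoint, ofReal, smul_smul]

theorem IsIntrinsicDecaying.integrable_path (hg : IsIntrinsicDecaying θ g)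
    (hJ : J ∈ unitSphere n) (hε : ε = 1 ∨ ε = -1) (h0 : 0 < φ) (hφ : φ < θ) :
    Integrable (fun t => ‖g (sectorPath φ J ε t)‖ / |t|) := by
  -- Each half of the path is a ray at an angle in `I_θ`: `-φ` and `φ` for `ε = 1`, and `π - φ` and
  -- `π + φ` for `ε = -1`.
  have key : ∃ ψ₁ ∈ angleSet θ, ∃ ψ₂ ∈ angleSet θ, ∀ t : ℝ, 0 < t →
      sectorPath φ J ε t = t • expI J ψ₁ ∧ sectorPath φ J ε (-t) = t • expI J ψ₂ := by
    simp only [sectorPath_eq, smul_expI]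
    rcases hε with rfl | rfl
    · refine ⟨-φ, Or.inl ⟨by linarith, by linarith⟩, φ, Or.inl ⟨by linarith, by linarith⟩,
        fun t ht => ?_⟩
      simp [abs_of_pos ht]
    · refine ⟨Real.pi - φ, Or.inr ⟨by linarith, by linarith⟩, φ + Real.pi,
        Or.inr ⟨by linarith, by linarith⟩, fun t ht => ?_⟩
      simp [abs_of_pos ht, Real.cos_add_pi, Real.sin_add_pi]
  obtain ⟨ψ₁, hψ₁, ψ₂, hψ₂, h⟩ := key
  have hpos : IntegrableOn (fun t => ‖g (sectorPath φ J ε t)‖ / |t|) (Ioi 0) := by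
    refine (hg.integrable J hJ ψ₁ hψ₁).congr_fun (fun t ht => ?_) measurableSet_Ioi
    dsimp only
    rw [(h t ht).1, abs_of_pos ht]
  have hneg : IntegrableOn (fun t => ‖g (sectorPath φ J ε t)‖ / |t|) (Iio 0) := by
    have h1 : IntegrableOn (fun t => ‖g (sectorPath φ J ε (-t))‖ / |-t|) (Ioi 0) := by
      refine (hg.integrable J hJ ψ₂ hψ₂).congr_fun (fun t ht => ?_) measurableSet_Ioi
      dsimp only
      rw [(h t ht).2, abs_neg, abs_of_pos ht]
    rw [← neg_zero] at h1
    simpa using h1.comp_neg_Iio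
  have h2 := ((integrableOn_Ici_iff_integrableOn_Ioi (by simp)).2 hpos).union hneg
  have h3 : Ici (0 : ℝ) ∪ Iio 0 = univ := by
    rw [union_comm]
    exact Iio_union_Ici
  rwa [h3, integrableOn_univ] at h2

end Intrinsic

/-! ### The integrand -/

section Integrand

variable {n : ℕ} {X : Type*} [NormedAddCommGroup X] [NormedSpace ℝ X]
  {T : CliffordModule n X →ₗ.[ℝ] CliffordModule n X} {J : Clifford n} {φ θ ω ε t : ℝ}
  {g : Clifford n → Clifford n}

theorem neg_slicePoint (x y : ℝ) : -slicePoint J x y = slicePoint J (-x) (-y) := by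
  simp only [slicePoint, ofReal]
  module

/-- The pairs `(x, y)`, `(c, d)`, `(a, b)` stand for `s`, `γ'` and `g(s)`. Under `(y, c, b) ↦ (-y,
-c, -b)` the coefficients of the terms with `lmul J` are odd and the other two are even. -/
theorem leftResolvent_comp_slicePoint (T : CliffordModule n X →ₗ.[ℝ] CliffordModule n X)
    (hJ : J ∈ unitSphere n) (x y c d a b : ℝ) :
    leftResolvent (slicePoint J x y) T ∘L
        lmul (lmul (-(lmul (slicePoint J c d) J)) (slicePoint J a b)) =
      (x * (d * a + c * b) + y * (d * b - c * a)) • qInv (slicePoint J x y) T +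
        (x * (d * b - c * a) - y * (d * a + c * b)) • (qInv (slicePoint J x y) T ∘L lmul J) -
        ((d * a + c * b) • opQInv (slicePoint J x y) T +
          (d * b - c * a) • (opQInv (slicePoint J x y) T ∘L lmul J)) := by
  rw [slicePoint_mul_unit hJ, neg_slicePoint, neg_neg, slicePoint_mul_slicePoint hJ,
    leftResolvent_eq, conj_slicePoint hJ, ContinuousLinearMap.sub_comp,
    ContinuousLinearMap.comp_assoc, lmul_slicePoint_comp hJ, lmul_slicePoint]
  ext1 v
  simp only [_root_.sub_apply, _root_.add_apply, _root_.smul_apply,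
    ContinuousLinearMap.comp_apply, ContinuousLinearMap.id_apply, map_add, map_smul]
  module

/-- The contributions of conjugate points: only real multiples of `Q_s[T]⁻¹` and `T Q_s[T]⁻¹`
remain. -/
theorem leftResolvent_comp_add_conj (T : CliffordModule n X →ₗ.[ℝ] CliffordModule n X)
    (hJ : J ∈ unitSphere n) (x y c d a b : ℝ) :
    leftResolvent (slicePoint J x y) T ∘L
        lmul (lmul (-(lmul (slicePoint J c d) J)) (slicePoint J a b)) +
      leftResolvent (slicePoint J x (-y)) T ∘L
        lmul (lmul (-(lmul (slicePoint J (-c) d) J)) (slicePoint J a (-b))) =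
      (2 * (x * (d * a + c * b) + y * (d * b - c * a))) • qInv (slicePoint J x y) T -
        (2 * (d * a + c * b)) • opQInv (slicePoint J x y) T := by
  have h1 : re (slicePoint J x (-y)) = re (slicePoint J x y) := by
    rw [re_slicePoint hJ, re_slicePoint hJ]
  have h2 : ‖slicePoint J x (-y)‖ = ‖slicePoint J x y‖ := by
    rw [norm_slicePoint hJ, norm_slicePoint hJ, neg_sq]
  rw [leftResolvent_comp_slicePoint T hJ, leftResolvent_comp_slicePoint T hJ, qInv_congr h1 h2,
    opQInv_congr h1 h2]
  module

theorem omegaIntegrand_add_neg (T : CliffordModule n X →ₗ.[ℝ] CliffordModule n X)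
    (hg : IsIntrinsic (doubleSector n θ) g) (hJ : J ∈ unitSphere n) (hε : ε = 1 ∨ ε = -1)
    (h0 : 0 < φ) (hφ : φ < θ) (hθ : θ < Real.pi / 2) (ht : t ≠ 0) :
    ∃ α β : ℝ, omegaIntegrand T φ J g ε t + omegaIntegrand T φ J g ε (-t) =
      α • qInv (sectorPath φ J ε t) T - β • opQInv (sectorPath φ J ε t) T := by
  obtain ⟨a, b, hab⟩ := hg.exists_components hJ hε h0 hφ hθ
  obtain ⟨h1, h2, h3⟩ := hab t ht
  -- At `-t` the point and the value of `g` are conjugated, while `γ'` changes the sign of its real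
  -- part.
  have h4 := (hab (-t) (neg_ne_zero.2 ht)).1
  rw [h2, h3] at h4
  have h5 := leftResolvent_comp_add_conj T hJ (ε * |t| * Real.cos φ) (-(ε * t * Real.sin φ))
    (ε * (t / |t|) * Real.cos φ) (-(ε * Real.sin φ)) (a t) (b t)
  refine ⟨_, _, Eq.trans ?_ (h5.trans (by rw [sectorPath_eq]))⟩
  unfold omegaIntegrand
  rw [h1, h4, deriv_sectorPath ht, deriv_sectorPath (neg_ne_zero.2 ht), sectorPath_eq,
    sectorPath_eq, abs_neg]
  congr 5
  · ring
  · congr 4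
    ring

theorem IsBisectorial.mem_resolventSet (hT : IsBisectorial ω T) {s : Clifford n}
    (hs : s ∈ paravectors n) (hs' : s ∉ closure (doubleSector n ω)) : s ∈ resolventSet T := by
  by_contra h
  exact hs' (hT.sSpectrum_subset ⟨hs, h⟩)

variable [CompleteSpace X]

theorem continuousOn_omegaIntegrand (hT : IsBisectorial ω T) (hω : 0 < ω) (hωφ : ω < φ)
    (hφ : φ < θ) (hθ : θ < Real.pi / 2) (hg : IsIntrinsic (doubleSector n θ) g)
    (hJ : J ∈ unitSphere n) (hε : ε = 1 ∨ ε = -1) :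
    ContinuousOn (omegaIntegrand T φ J g ε) {0}ᶜ := by
  have hpath : Continuous (sectorPath φ J ε) := by
    have h0 : sectorPath φ J ε = fun t => slicePoint J (ε * |t| * Real.cos φ)
      (-(ε * t * Real.sin φ)) := funext (sectorPath_eq φ J ε)
    rw [h0]
    exact (continuous_slicePoint J).comp (f := fun t : ℝ => (ε * |t| * Real.cos φ,
      -(ε * t * Real.sin φ))) (by fun_prop)
  have hmaps : MapsTo (sectorPath φ J ε) {0}ᶜ (resolventSet T) := fun t ht =>
    hT.mem_resolventSet (sectorPath_mem_paravectors hJ)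
      (sectorPath_notMem_closure hJ hε hω hωφ (by linarith) ht)
  have hQ : ContinuousOn (fun t => qInv (sectorPath φ J ε t) T) {0}ᶜ :=
    ContinuousOn.comp (g := fun s => qInv s T) (f := sectorPath φ J ε)
      (continuousOn_qInv hT.isClosedOperator).1 hpath.continuousOn hmaps
  have hU : ContinuousOn (fun t => opQInv (sectorPath φ J ε t) T) {0}ᶜ :=
    ContinuousOn.comp (g := fun s => opQInv s T) (f := sectorPath φ J ε)
      (continuousOn_qInv hT.isClosedOperator).2 hpath.continuousOn hmaps
  have hl : Continuous fun t =>
      (lmul (conj (sectorPath φ J ε t)) : CliffordModule n X →L[ℝ] CliffordModule n X) :=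
    continuous_lmul.comp (continuous_conj.comp hpath)
  have hR : ContinuousOn (fun t => leftResolvent (sectorPath φ J ε t) T) {0}ᶜ := by
    simp only [leftResolvent_eq]
    exact (hQ.clm_comp hl.continuousOn).sub hU
  have hd : ContinuousOn (deriv (sectorPath φ J ε)) {0}ᶜ := by
    have h1 : ContinuousOn (fun t : ℝ => (ε * (t / |t|) * Real.cos φ, -(ε * Real.sin φ))) {0}ᶜ := by
      have h2 : ContinuousOn (fun t : ℝ => t / |t|) {0}ᶜ :=
        continuousOn_id.div continuous_abs.continuousOn fun t ht => abs_ne_zero.2 ht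
      fun_prop
    exact ((continuous_slicePoint J).comp_continuousOn h1).congr fun t ht => deriv_sectorPath ht
  have hd' : ContinuousOn (fun t => -(lmul (deriv (sectorPath φ J ε) t) J)) {0}ᶜ :=
    ((continuous_lmul.comp_continuousOn hd).clm_apply continuousOn_const).neg
  have ha : ContinuousOn (fun t => lmul (-(lmul (deriv (sectorPath φ J ε) t) J))
      (g (sectorPath φ J ε t))) {0}ᶜ :=
    (continuous_lmul.comp_continuousOn hd').clm_apply
      (hg.continuousOn_path hJ hε (hω.trans hωφ) hφ hθ)
  have hla : ContinuousOn (fun t => (lmul (lmul (-(lmul (deriv (sectorPath φ J ε) t) J))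
      (g (sectorPath φ J ε t))) : CliffordModule n X →L[ℝ] CliffordModule n X)) {0}ᶜ :=
    continuous_lmul.comp_continuousOn ha
  exact hR.clm_comp hla

theorem integrable_omegaIntegrand (hT : IsBisectorial ω T) (hω : 0 < ω) (hωφ : ω < φ)
    (hφ : φ < θ) (hθ : θ < Real.pi / 2) (hg : IsIntrinsicDecaying θ g)
    (hJ : J ∈ unitSphere n) (hε : ε = 1 ∨ ε = -1) :
    Integrable (omegaIntegrand T φ J g ε) := by
  obtain ⟨C, hC0, hC⟩ := hT.bound φ ⟨hωφ, hφ.trans hθ⟩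
  -- `K` controls the action on `V` and `L` the product in `ℝ_n`, whose norm is not
  -- submultiplicative in general.
  obtain ⟨K, hK0, hK⟩ := exists_norm_lmul_le n X
  obtain ⟨L, hL0, hL⟩ := exists_norm_lmul_le n ℝ
  have hae : ∀ᵐ t : ℝ, t ≠ 0 := by simp [ae_iff]
  have hmeas : AEStronglyMeasurable (omegaIntegrand T φ J g ε) volume := by
    have h1 := (continuousOn_omegaIntegrand hT hω hωφ hφ hθ hg.intrinsic hJ hε).aestronglyMeasurable
      (μ := volume) (measurableSet_singleton (0 : ℝ)).compl
    rwa [Measure.restrict_eq_self_of_ae_mem] at h1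
    exact hae
  refine ((hg.integrable_path hJ hε (hω.trans hωφ) hφ).const_mul (C * K * L)).mono' hmeas ?_
  filter_upwards [hae] with t ht
  have h1 := hC (sectorPath φ J ε t) ⟨sectorPath_mem_paravectors hJ, by
    rintro (h | h)
    · exact sectorPath_notMem_doubleSector hJ hε (hω.trans hωφ) (hφ.trans hθ) ht h
    · exact sectorPath_ne_zero hJ hε ht h⟩
  rw [norm_sectorPath hJ hε] at h1
  -- The path has unit speed and multiplication by `J` rotates `ℂ_J`.
  have h2 : ‖-(lmul (deriv (sectorPath φ J ε) t) J)‖ = 1 := by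
    rw [norm_neg, deriv_sectorPath ht, slicePoint_mul_unit hJ, norm_slicePoint hJ,
      Real.sqrt_eq_one]
    have hε2 : ε ^ 2 = 1 := by rcases hε with rfl | rfl <;> norm_num
    have ht2 : (t / |t|) ^ 2 = 1 := by
      rw [div_pow, sq_abs, div_self (pow_ne_zero 2 ht)]
    linear_combination (Real.sin φ ^ 2 + Real.cos φ ^ 2 * (t / |t|) ^ 2) * hε2 +
      Real.cos φ ^ 2 * ht2 + Real.sin_sq_add_cos_sq φ
  have h3 : ‖lmul (-(lmul (deriv (sectorPath φ J ε) t) J)) (g (sectorPath φ J ε t))‖ ≤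
      L * ‖g (sectorPath φ J ε t)‖ := by
    refine (ContinuousLinearMap.le_opNorm _ _).trans ?_
    have := hL (-(lmul (deriv (sectorPath φ J ε) t) J))
    rw [h2, mul_one] at this
    gcongr
  calc ‖omegaIntegrand T φ J g ε t‖
      ≤ ‖leftResolvent (sectorPath φ J ε t) T‖ *
          ‖(lmul (lmul (-(lmul (deriv (sectorPath φ J ε) t) J)) (g (sectorPath φ J ε t))) :
            CliffordModule n X →L[ℝ] CliffordModule n X)‖ := ContinuousLinearMap.opNorm_comp_le _ _
    _ ≤ (C / |t|) * (K * (L * ‖g (sectorPath φ J ε t)‖)) := by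
        have h4 := (hK (lmul (-(lmul (deriv (sectorPath φ J ε) t) J))
          (g (sectorPath φ J ε t)))).trans (mul_le_mul_of_nonneg_left h3 hK0)
        exact mul_le_mul h1 h4 (ContinuousLinearMap.opNorm_nonneg _) (by positivity)
    _ = C * K * L * (‖g (sectorPath φ J ε t)‖ / |t|) := by ring

end Integrand

/-! ### Commutation properties of the calculus -/

section Calculus

/-- Hahn–Banach: a functional separating the integral from `W` is bounded above on `W`, hence
vanishes on `W` and so on the integral. -/
theorem integral_mem_of_isClosed_submodule {α E : Type*} [MeasurableSpace α] {μ : Measure α}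
    [NormedAddCommGroup E] [NormedSpace ℝ E] [CompleteSpace E] (W : Submodule ℝ E)
    (hW : IsClosed (W : Set E)) {f : α → E} (hf : Integrable f μ) (h : ∀ᵐ a ∂μ, f a ∈ W) :
    ∫ a, f a ∂μ ∈ W := by
  by_contra hx
  obtain ⟨l, u, h1, h2⟩ := geometric_hahn_banach_closed_point W.convex hW hx
  have h3 : ∀ w ∈ W, l w = 0 := by
    intro w hw
    by_contra hne
    have := h1 (((u + 1) / l w) • w) (W.smul_mem _ hw)
    rw [map_smul, smul_eq_mul, div_mul_cancel₀ _ hne] at this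
    linarith
  have h4 : l (∫ a, f a ∂μ) = 0 := by
    rw [← ContinuousLinearMap.integral_comp_comm l hf]
    exact integral_eq_zero_of_ae (h.mono fun a ha => h3 _ ha)
  have h5 := h1 0 W.zero_mem
  rw [map_zero] at h5
  linarith

variable {n : ℕ} {X : Type*} [NormedAddCommGroup X] [NormedSpace ℝ X]
  {S : CliffordModule n X →ₗ.[ℝ] CliffordModule n X}

/-- The bounded maps that preserve the graph of `S`. -/
def preservingSubmodule (S : CliffordModule n X →ₗ.[ℝ] CliffordModule n X) :
    Submodule ℝ (CliffordModule n X →L[ℝ] CliffordModule n X) where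
  carrier := {B | PreservesGraph B S}
  add_mem' hB hB' x y h := S.graph.add_mem (hB x y h) (hB' x y h)
  zero_mem' _ _ _ := S.graph.zero_mem
  smul_mem' r _ hB x y h := S.graph.smul_mem r (hB x y h)

/-- Each point of the graph imposes a closed condition on `B`, because evaluation is continuous in
operator norm. -/
theorem isClosed_preservingSubmodule (hS : S.IsClosed) :
    IsClosed (preservingSubmodule S : Set (CliffordModule n X →L[ℝ] CliffordModule n X)) := by
  have h : (preservingSubmodule S : Set (CliffordModule n X →L[ℝ] CliffordModule n X)) =
      ⋂ p ∈ S.graph, (fun B : CliffordModule n X →L[ℝ] CliffordModule n X =>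
        (B p.1, B p.2)) ⁻¹' S.graph := by
    ext B
    simp only [mem_iInter]
    exact ⟨fun hB p hp => hB p.1 p.2 hp, fun hB x y hxy => hB (x, y) hxy⟩
  rw [h]
  refine isClosed_biInter fun p _ => IsClosed.preimage ?_ hS
  fun_prop

variable [CompleteSpace X] {T : CliffordModule n X →ₗ.[ℝ] CliffordModule n X} {J : Clifford n}
  {φ θ ω ε : ℝ} {g : Clifford n → Clifford n}

/-- A single value of the integrand contains `lmul J`, which need not preserve the graph of `S`. The
symmetrized integrand avoids it and has twice the integral. -/
theorem preservesGraph_integral_omegaIntegrand (hT : IsBisectorial ω T) (hω : 0 < ω)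
    (hωφ : ω < φ) (hφ : φ < θ) (hθ : θ < Real.pi / 2) (hg : IsIntrinsicDecaying θ g)
    (hJ : J ∈ unitSphere n) (hε : ε = 1 ∨ ε = -1) (hS : S.IsClosed)
    (h : ∀ s ∈ paravectors n \ closure (doubleSector n ω),
      PreservesGraph (qInv s T) S ∧ PreservesGraph (opQInv s T) S) :
    PreservesGraph (∫ t, omegaIntegrand T φ J g ε t) S := by
  have hI := integrable_omegaIntegrand hT hω hωφ hφ hθ hg hJ hε
  have h1 : ∫ t, (omegaIntegrand T φ J g ε t + omegaIntegrand T φ J g ε (-t)) ∈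
      preservingSubmodule S := by
    refine integral_mem_of_isClosed_submodule _ (isClosed_preservingSubmodule hS)
      (hI.add hI.comp_neg) ?_
    have hae : ∀ᵐ t : ℝ, t ≠ 0 := by simp [ae_iff]
    filter_upwards [hae] with t ht
    obtain ⟨α, β, hαβ⟩ := omegaIntegrand_add_neg T hg.intrinsic hJ hε (hω.trans hωφ) hφ hθ ht
    obtain ⟨h2, h3⟩ := h (sectorPath φ J ε t) ⟨sectorPath_mem_paravectors hJ,
      sectorPath_notMem_closure hJ hε hω hωφ (hφ.trans hθ) ht⟩
    rw [hαβ]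
    exact Submodule.sub_mem _ (Submodule.smul_mem _ _ h2) (Submodule.smul_mem _ _ h3)
  rw [integral_add hI hI.comp_neg, integral_neg_eq_self] at h1
  have h2 := (preservingSubmodule S).smul_mem (1 / 2 : ℝ) h1
  rw [← two_smul ℝ, smul_smul] at h2
  norm_num at h2
  exact h2

/-- `g(T)` commutes with every closed operator that commutes with all `Q_s[T]⁻¹` and
`T Q_s[T]⁻¹`. -/
theorem preservesGraph_omegaCalc (hT : IsBisectorial ω T) (hω : 0 < ω)
    (hωφ : ω < φ) (hφ : φ < θ) (hθ : θ < Real.pi / 2) (hg : IsIntrinsicDecaying θ g)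
    (hJ : J ∈ unitSphere n) (hS : S.IsClosed)
    (h : ∀ s ∈ paravectors n \ closure (doubleSector n ω),
      PreservesGraph (qInv s T) S ∧ PreservesGraph (opQInv s T) S) :
    PreservesGraph (omegaCalc T φ J g) S :=
  (preservingSubmodule S).smul_mem _ ((preservingSubmodule S).add_mem
    (preservesGraph_integral_omegaIntegrand hT hω hωφ hφ hθ hg hJ (Or.inl rfl) hS h)
    (preservesGraph_integral_omegaIntegrand hT hω hωφ hφ hθ hg hJ (Or.inr rfl) hS h))

omit [CompleteSpace X] in
theorem isClosed_toOp (B : CliffordModule n X →L[ℝ] CliffordModule n X) :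
    (toOp B).IsClosed := by
  have h : ((toOp B).graph : Set (CliffordModule n X × CliffordModule n X)) =
      {p | B p.1 = p.2} := by
    ext ⟨x, y⟩
    exact mem_graph_toOp
  unfold LinearPMap.IsClosed
  rw [h]
  exact isClosed_eq (by fun_prop) (by fun_prop)

/-- Here `B` itself is the closed operator: preserving the graph of a bounded map means commuting
with it. -/
theorem PreservesGraph.comm_omegaCalc (hT : IsBisectorial ω T) (hω : 0 < ω)
    (hωφ : ω < φ) (hφ : φ < θ) (hθ : θ < Real.pi / 2) (hg : IsIntrinsicDecaying θ g)
    (hJ : J ∈ unitSphere n) {B : CliffordModule n X →L[ℝ] CliffordModule n X}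
    (hB : PreservesGraph B T) : B ∘L omegaCalc T φ J g = omegaCalc T φ J g ∘L B := by
  refine preservesGraph_toOp_iff.1 (preservesGraph_omegaCalc hT hω hωφ hφ hθ hg hJ
    (isClosed_toOp B) fun s hs => ?_)
  have h := hB.comm_qInv hT.isClosedOperator (hT.mem_resolventSet hs.1 hs.2)
  exact ⟨preservesGraph_toOp_iff.2 h.1, preservesGraph_toOp_iff.2 h.2⟩

theorem omegaCalc_preservesGraph_self (hT : IsBisectorial ω T) (hω : 0 < ω)
    (hωφ : ω < φ) (hφ : φ < θ) (hθ : θ < Real.pi / 2) (hg : IsIntrinsicDecaying θ g)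
    (hJ : J ∈ unitSphere n) : PreservesGraph (omegaCalc T φ J g) T :=
  preservesGraph_omegaCalc hT hω hωφ hφ hθ hg hJ hT.isClosedOperator.isClosed fun _ hs =>
    qInv_preservesGraph hT.isClosedOperator (hT.mem_resolventSet hs.1 hs.2)

end Calculus

end CliffordOp

end

/-! ### The main theorem -/

theorem mainTheorem4 {n : ℕ} {X : Type*} [NormedAddCommGroup X] [NormedSpace ℝ X] [CompleteSpace X]
    (T : CliffordOp.CliffordModule n X →ₗ.[ℝ] CliffordOp.CliffordModule n X)
    (ω θ : ℝ) (hω : 0 < ω) (hωθ : ω < θ) (hθ : θ < Real.pi / 2)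
    (hT : CliffordOp.IsBisectorial ω T)
    (g : CliffordOp.Clifford n → CliffordOp.Clifford n)
    (hg : CliffordOp.IsIntrinsicDecaying θ g)
    (φ : ℝ) (hφ : φ ∈ Set.Ioo ω θ)
    (J : CliffordOp.Clifford n) (hJ : J ∈ CliffordOp.unitSphere n) :
    -- the integrals that define `g(T)` converge absolutely
    (MeasureTheory.Integrable (CliffordOp.omegaIntegrand T φ J g 1) ∧
      MeasureTheory.Integrable (CliffordOp.omegaIntegrand T φ J g (-1))) ∧
    -- commutation with closed operators
    (∀ A : CliffordOp.CliffordModule n X →ₗ.[ℝ] CliffordOp.CliffordModule n X,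
      CliffordOp.IsClosedOperator A →
      (∀ s ∈ CliffordOp.paravectors n \ closure (CliffordOp.doubleSector n ω),
        CliffordOp.opMul (CliffordOp.toOp (CliffordOp.qInv s T)) A ≤
            CliffordOp.opMul A (CliffordOp.toOp (CliffordOp.qInv s T)) ∧
          CliffordOp.opMul (CliffordOp.opMul T (CliffordOp.toOp (CliffordOp.qInv s T))) A ≤
            CliffordOp.opMul A (CliffordOp.opMul T (CliffordOp.toOp (CliffordOp.qInv s T)))) →
      CliffordOp.opMul (CliffordOp.toOp (CliffordOp.omegaCalc T φ J g)) A ≤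
        CliffordOp.opMul A (CliffordOp.toOp (CliffordOp.omegaCalc T φ J g))) ∧
    -- commutation with bounded operators
    (∀ B : CliffordOp.CliffordModule n X →L[ℝ] CliffordOp.CliffordModule n X,
      CliffordOp.IsRightLinear B →
      CliffordOp.opMul (CliffordOp.toOp B) T ≤ CliffordOp.opMul T (CliffordOp.toOp B) →
      B ∘L CliffordOp.omegaCalc T φ J g = CliffordOp.omegaCalc T φ J g ∘L B) ∧
    -- commutation with real polynomials of `T`
    (∀ p : Polynomial ℝ,
      CliffordOp.opMul (CliffordOp.toOp (CliffordOp.omegaCalc T φ J g)) (CliffordOp.polyOp p T) ≤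
        CliffordOp.opMul (CliffordOp.polyOp p T)
          (CliffordOp.toOp (CliffordOp.omegaCalc T φ J g))) ∧
    -- commutation between intrinsic calculi
    (∀ f : CliffordOp.Clifford n → CliffordOp.Clifford n, CliffordOp.IsIntrinsicDecaying θ f →
      ∀ φ' ∈ Set.Ioo ω θ, ∀ J' ∈ CliffordOp.unitSphere n,
        CliffordOp.omegaCalc T φ J g ∘L CliffordOp.omegaCalc T φ' J' f =
          CliffordOp.omegaCalc T φ' J' f ∘L CliffordOp.omegaCalc T φ J g) := by
  obtain ⟨hφ1, hφ2⟩ := hφ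
  refine ⟨⟨CliffordOp.integrable_omegaIntegrand hT hω hφ1 hφ2 hθ hg hJ (Or.inl rfl),
    CliffordOp.integrable_omegaIntegrand hT hω hφ1 hφ2 hθ hg hJ (Or.inr rfl)⟩,
    fun A hA h => ?_, fun B _ hB => ?_, fun p => ?_, fun f hf φ' hφ' J' hJ' => ?_⟩
  · refine CliffordOp.opMul_toOp_le_iff.2 (CliffordOp.preservesGraph_omegaCalc hT hω hφ1 hφ2 hθ hg
      hJ hA.isClosed fun s hs => ?_)
    obtain ⟨h1, h2⟩ := h s hs
    rw [← CliffordOp.toOp_opQInv hT.isClosedOperator (hT.mem_resolventSet hs.1 hs.2)] at h2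
    exact ⟨CliffordOp.opMul_toOp_le_iff.1 h1, CliffordOp.opMul_toOp_le_iff.1 h2⟩
  · exact (CliffordOp.opMul_toOp_le_iff.1 hB).comm_omegaCalc hT hω hφ1 hφ2 hθ hg hJ
  · exact CliffordOp.opMul_toOp_le_iff.2
      ((CliffordOp.omegaCalc_preservesGraph_self hT hω hφ1 hφ2 hθ hg hJ).polyOp p)
  -- `g(T)` plays the role of `B` for the calculus of `f`, so the angles and imaginary units need
  -- not agree.
  · exact (CliffordOp.omegaCalc_preservesGraph_self hT hω hφ1 hφ2 hθ hg hJ).comm_omegaCalc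
      hT hω hφ'.1 hφ'.2 hθ hf hJ'
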